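/- Let $\mathcal H_1$ be a finite-dimensional complex Hilbert space and $\mathcal H_2$ an arbitrary complex Hilbert space. For a C*-algebra $\mathcal A$ acting on $\mathcal H\otimes\mathcal K$, with $\mathcal H$ finite-dimensional and $\mathcal B(\mathcal H)\otimes\mathbf 1\subseteq\mathcal A$, let $\mathcal S(\mathcal A)$ be the set of states (positive normalized linear functionals) of $\mathcal A$ with the weak-$*$ topology, and for $\omega\in\mathcal S(\mathcal A)$ let $M_\omega(\mathcal S(\mathcal A))$ be the set of Radon probability measures $\mu$ on $\mathcal S(\mathcal A)$ with barycenter $\omega$, i.e. $\int\varphi(a)\,d\mu(\varphi)=\omega(a)$ for all $a\in\mathcal A$. The entanglement of formation of $\omega$ is $$E(\omega)=\inf_{\mu\in M_\omega(\mathcal S(\mathcal A))}\int_{\mathcal S(\mathcal A)}S(r\varphi)\,d\mu(\varphi),$$ where $(r\varphi)(a)=\varphi(a\otimes\mathbf 1)$ for $a\in\mathcal B(\mathcal H)$ and $S(\psi)=-\mathrm{Tr}\,\varrho_\psi\log\varrho_\psi$ is the von Neumann entropy of the state $\psi$ of $\mathcal B(\mathcal H)$ with density matrix $\varrho_\psi$.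 (i) Let $\mathcal M\subseteq\mathcal B(\mathcal H_2)$ be a unital C*-algebra and $\omega$ a state of $\mathcal B(\mathcal H_1)\otimes\mathcal M$. On the spatial C*-tensor product $\mathcal B(\mathcal H_1)\otimes\mathcal M\otimes\mathcal B(\mathcal H_1)\otimes\mathcal M$, regarded as $\mathcal B(\mathcal H_1\otimes\mathcal H_1)\otimes(\mathcal M\otimes\mathcal M)$ acting on $(\mathcal H_1\otimes\mathcal H_1)\otimes(\mathcal H_2\otimes\mathcal H_2)$, there is exactly one state $\omega\otimes\omega$ with $$(\omega\otimes\omega)\big((a\otimes b)\otimes(m\otimes n)\big)=\omega(a\otimes m)\,\omega(b\otimes n)\qquad(a,b\in\mathcal B(\mathcal H_1),\ m,n\in\mathcal M),$$ and its entanglement of formation, with the entropy taken on $\mathcal B(\mathcal H_1)\otimes\mathcal B(\mathcal H_1)=\mathcal B(\mathcal H_1\otimes\mathcal H_1)$, satisfies $$E(\omega\otimes\omega)\le 2\,E(\omega).$$ (ii) Let $\mathcal M\subseteq\mathcal B(\mathcal H_2)$ be a von Neumann algebra and $\omega$ a normal state of $\mathcal B(\mathcal H_1)\otimes\mathcal M$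 (one given by a density matrix on $\mathcal H_1\otimes\mathcal H_2$). Then on the von Neumann algebra tensor product $\mathcal B(\mathcal H_1)\,\overline\otimes\,\mathcal M\,\overline\otimes\,\mathcal B(\mathcal H_1)\,\overline\otimes\,\mathcal M$ there is exactly one normal state $\omega\otimes\omega$ with the same product property, and again $E(\omega\otimes\omega)\le 2\,E(\omega)$. -/

import Mathlib

open MeasureTheory TensorProduct
open scoped ComplexOrder

noncomputable section

namespace EntForm

/-! ### States -/

section States

variable (A : Type*) [NormedRing A] [NormedAlgebra ℂ A] [StarRing A]

/-- The state space of a unital C*-algebra: positive normalized linear functionals. -/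
def State : Type _ :=
  {φ : WeakDual ℂ A // φ 1 = 1 ∧ ∀ a : A, 0 ≤ φ (star a * a)}

variable {A}

instance : CoeFun (State A) (fun _ => A → ℂ) := ⟨fun φ a => φ.1 a⟩

/-- The state space carries the weak-* topology. -/
instance : TopologicalSpace (State A) := instTopologicalSpaceSubtype

instance : MeasurableSpace (State A) := borel _

instance : BorelSpace (State A) := ⟨rfl⟩

theorem State.map_star (φ : State A) [StarModule ℂ A] (a : A) :
    φ (star a) = star (φ a) := by
  have h0 : ∀ b : A, (φ (star b * b)).im = 0 := fun b => (Complex.nonneg_iff.mp (φ.2.2 b)).2.symm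
  have hone : φ.1 1 = 1 := φ.2.1
  have e1 := h0 (1 + a)
  have e2 := h0 (1 + Complex.I • a)
  have e3 := h0 a
  simp only [star_add, star_one, star_smul, mul_add, add_mul, one_mul, mul_one, map_add,
    smul_mul_assoc, mul_smul_comm, map_smul, hone, smul_eq_mul] at e1 e2 e3
  simp only [RCLike.star_def, Complex.conj_I, Complex.add_im, Complex.mul_im, Complex.neg_im,
    Complex.neg_re, Complex.mul_re, Complex.I_re, Complex.I_im, Complex.one_im, e3] at e1 e2
  apply Complex.ext
  · simp only [RCLike.star_def, Complex.conj_re]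
    linarith
  · simp only [RCLike.star_def, Complex.conj_im]
    linarith

/-- Pull-back of states along a continuous unital *-homomorphism. -/
def State.comap {B : Type*} [NormedRing B] [NormedAlgebra ℂ B] [StarRing B]
    (f : A →⋆ₐ[ℂ] B) (hf : Continuous f) (φ : State B) : State A :=
  ⟨StrongDual.toWeakDual ((WeakDual.toStrongDual φ.1).comp
      ⟨f.toAlgHom.toLinearMap, hf⟩),
    by
      change φ.1 (f 1) = 1
      rw [map_one]; exact φ.2.1,
    fun a => by
      change 0 ≤ φ.1 (f (star a * a))
      rw [map_mul, StarHomClass.map_star]; exact φ.2.2 (f a)⟩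

@[simp] theorem State.comap_apply {B : Type*} [NormedRing B] [NormedAlgebra ℂ B] [StarRing B]
    (f : A →⋆ₐ[ℂ] B) (hf : Continuous f) (φ : State B) (a : A) :
    φ.comap f hf a = φ (f a) := rfl

/-- Radon probability measures on the state space with barycenter `ω` (in the weak sense). -/
def measuresWithBarycenter (ω : State A) : Set (Measure (State A)) :=
  {μ | IsProbabilityMeasure μ ∧ μ.Regular ∧ ∀ a : A, ∫ φ : State A, φ a ∂μ = ω a}

end States

/-! ### The von Neumann entropy of a state on `B(H)`, `H` finite dimensional -/

section Entropy

variable {H : Type*} [NormedAddCommGroup H] [InnerProductSpace ℂ H] [CompleteSpace H]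
  [FiniteDimensional ℂ H]

/-- The density matrix of a state of `B(H)`, written in an orthonormal basis `e` of `H`:
`ρ i j = ⟨e i, ρ (e j)⟩ = Tr (ρ |e j⟩⟨e i|) = φ (|e j⟩⟨e i|)`. -/
def densityMatrix (φ : State (H →L[ℂ] H)) :
    Matrix (Fin (Module.finrank ℂ H)) (Fin (Module.finrank ℂ H)) ℂ :=
  Matrix.of fun i j => φ (InnerProductSpace.rankOne ℂ (stdOrthonormalBasis ℂ H j)
    (stdOrthonormalBasis ℂ H i))

theorem densityMatrix_isHermitian (φ : State (H →L[ℂ] H)) : (densityMatrix φ).IsHermitian := by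
  ext i j
  simp only [Matrix.conjTranspose_apply, densityMatrix, Matrix.of_apply]
  rw [← State.map_star, ContinuousLinearMap.star_eq_adjoint, InnerProductSpace.adjoint_rankOne]

/-- The density matrix determines the state: `φ a = Tr (ρ a)`. -/
theorem trace_densityMatrix_mul (φ : State (H →L[ℂ] H)) (a : H →L[ℂ] H) :
    (densityMatrix φ * LinearMap.toMatrix (stdOrthonormalBasis ℂ H).toBasis
      (stdOrthonormalBasis ℂ H).toBasis (a : H →ₗ[ℂ] H)).trace = φ a := by
  set e := stdOrthonormalBasis ℂ H
  have ha : a = ∑ i, ∑ j, inner ℂ (e j) (a (e i)) •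
      InnerProductSpace.rankOne ℂ (e j) (e i) := by
    ext x
    simp only [sum_apply, smul_apply,
      InnerProductSpace.rankOne_apply]
    conv_lhs => rw [← e.sum_repr' x, map_sum]
    refine Finset.sum_congr rfl fun i _ => ?_
    rw [map_smul]
    conv_lhs => rw [← e.sum_repr' (a (e i)), Finset.smul_sum]
    exact Finset.sum_congr rfl fun j _ => smul_comm _ _ _
  conv_rhs => rw [ha]
  simp only [map_sum, map_smul, Matrix.trace, Matrix.diag, Matrix.mul_apply, densityMatrix,
    Matrix.of_apply, LinearMap.toMatrix_apply, smul_eq_mul]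
  refine Finset.sum_congr rfl fun i _ => Finset.sum_congr rfl fun j _ => ?_
  rw [mul_comm]
  simp [e, OrthonormalBasis.repr_apply_apply]

/-- The von Neumann entropy `S(φ) = - Tr ρ log ρ = ∑ i, - λ i * log (λ i)`, where the `λ i` are the
eigenvalues, with multiplicity, of the density matrix of `φ`. -/
def vonNeumannEntropy (φ : State (H →L[ℂ] H)) : ℝ :=
  ∑ i, Real.negMulLog ((densityMatrix_isHermitian φ).eigenvalues i)

end Entropy

/-! ### Tensor products of Hilbert spaces, operators and operator algebras -/

section Tensor

variable (H K : Type*) [NormedAddCommGroup H] [InnerProductSpace ℂ H]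
  [NormedAddCommGroup K] [InnerProductSpace ℂ K]

/-- The Hilbert space tensor product: the completion of the algebraic tensor product. -/
def HTensor : Type _ := UniformSpace.Completion (H ⊗[ℂ] K)

instance : NormedAddCommGroup (HTensor H K) :=
  inferInstanceAs (NormedAddCommGroup (UniformSpace.Completion (H ⊗[ℂ] K)))

instance : InnerProductSpace ℂ (HTensor H K) :=
  inferInstanceAs (InnerProductSpace ℂ (UniformSpace.Completion (H ⊗[ℂ] K)))

instance : CompleteSpace (HTensor H K) :=
  inferInstanceAs (CompleteSpace (UniformSpace.Completion (H ⊗[ℂ] K)))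

/-- The isometric inclusion of the algebraic tensor product. -/
def HTensor.incl : H ⊗[ℂ] K →ₗᵢ[ℂ] HTensor H K :=
  (UniformSpace.Completion.toComplₗᵢ : H ⊗[ℂ] K →ₗᵢ[ℂ] UniformSpace.Completion (H ⊗[ℂ] K))

theorem HTensor.denseRange_incl : DenseRange (HTensor.incl H K) :=
  UniformSpace.Completion.denseRange_coe

instance [FiniteDimensional ℂ H] [FiniteDimensional ℂ K] :
    FiniteDimensional ℂ (HTensor H K) := by
  have : CompleteSpace (H ⊗[ℂ] K) := FiniteDimensional.complete ℂ _
  refine Module.Finite.of_surjective (HTensor.incl H K).toLinearMap fun x => ?_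
  have hr : IsClosed (Set.range (HTensor.incl H K)) :=
    (HTensor.incl H K).isometry.isUniformInducing.isComplete_range.isClosed
  have hx : x ∈ Set.range (HTensor.incl H K) := by
    rw [← hr.closure_eq]
    exact HTensor.denseRange_incl H K x
  exact hx

variable {H K}

/-- The elementary tensor `x ⊗ y` of two vectors. -/
def HTensor.tmul (x : H) (y : K) : HTensor H K := HTensor.incl H K (x ⊗ₜ[ℂ] y)

/-- The operator `a ⊗ b` on the Hilbert space tensor product: the continuous extension of the
algebraic tensor product of `a` and `b`. -/
def opTensor (a : H →L[ℂ] H) (b : K →L[ℂ] K) : HTensor H K →L[ℂ] HTensor H K :=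
  (TensorProduct.mapL a b).completion

theorem opTensor_incl (a : H →L[ℂ] H) (b : K →L[ℂ] K) (z : H ⊗[ℂ] K) :
    opTensor a b (HTensor.incl H K z) = HTensor.incl H K (TensorProduct.mapL a b z) :=
  ContinuousLinearMap.completion_apply_coe _ _

theorem op_ext {T S : HTensor H K →L[ℂ] HTensor H K}
    (h : ∀ (x : H) (y : K), T (HTensor.tmul x y) = S (HTensor.tmul x y)) : T = S := by
  ext z
  induction z using (HTensor.denseRange_incl H K).induction_on with
  | hp => exact isClosed_eq T.continuous S.continuous
  | ih z =>
    induction z using TensorProduct.induction_on with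
    | zero => simp only [map_zero]
    | tmul x y => exact h x y
    | add u v hu hv => simp only [map_add, hu, hv]

@[simp] theorem opTensor_tmul (a : H →L[ℂ] H) (b : K →L[ℂ] K) (x : H) (y : K) :
    opTensor a b (HTensor.tmul x y) = HTensor.tmul (a x) (b y) :=
  opTensor_incl a b _

theorem opTensor_mul (a a' : H →L[ℂ] H) (b b' : K →L[ℂ] K) :
    opTensor (a * a') (b * b') = opTensor a b * opTensor a' b' :=
  op_ext fun x y => by simp

theorem opTensor_one : opTensor (1 : H →L[ℂ] H) (1 : K →L[ℂ] K) = 1 :=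
  op_ext fun x y => by simp

theorem opTensor_add_left (a a' : H →L[ℂ] H) (b : K →L[ℂ] K) :
    opTensor (a + a') b = opTensor a b + opTensor a' b :=
  op_ext fun x y => by simp [HTensor.tmul, opTensor_incl, TensorProduct.add_tmul]

theorem opTensor_smul_left (c : ℂ) (a : H →L[ℂ] H) (b : K →L[ℂ] K) :
    opTensor (c • a) b = c • opTensor a b :=
  op_ext fun x y => by simp [HTensor.tmul, opTensor_incl, ← TensorProduct.smul_tmul']

variable [CompleteSpace H] [CompleteSpace K]

theorem opTensor_star (a : H →L[ℂ] H) (b : K →L[ℂ] K) :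
    opTensor (star a) (star b) = star (opTensor a b) := by
  rw [ContinuousLinearMap.star_eq_adjoint (opTensor a b), ContinuousLinearMap.eq_adjoint_iff]
  intro u v
  induction u, v using (HTensor.denseRange_incl H K).induction_on₂ with
  | hp => exact isClosed_eq (by fun_prop) (by fun_prop)
  | h u v =>
    rw [opTensor_incl, opTensor_incl, LinearIsometry.inner_map_map, LinearIsometry.inner_map_map]
    induction u using TensorProduct.induction_on with
    | zero => simp
    | add p q hp hq => rw [map_add, inner_add_left, inner_add_left, hp, hq]
    | tmul x y =>
      induction v using TensorProduct.induction_on with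
      | zero => simp
      | add p q hp hq => rw [map_add, inner_add_right, inner_add_right, hp, hq]
      | tmul z w =>
        simp [ContinuousLinearMap.star_eq_adjoint, ContinuousLinearMap.adjoint_inner_left]

/-- The *-homomorphism `a ↦ a ⊗ 1`. -/
def leftEmbedding : (H →L[ℂ] H) →⋆ₐ[ℂ] (HTensor H K →L[ℂ] HTensor H K) where
  toFun a := opTensor a 1
  map_one' := opTensor_one
  map_mul' a a' := by rw [← opTensor_mul, one_mul]
  map_zero' := by simpa using opTensor_smul_left (0 : ℂ) (0 : H →L[ℂ] H) (1 : K →L[ℂ] K)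
  map_add' a a' := opTensor_add_left a a' 1
  commutes' c := by
    rw [Algebra.algebraMap_eq_smul_one, Algebra.algebraMap_eq_smul_one, opTensor_smul_left,
      opTensor_one]
  map_star' a := by rw [← opTensor_star, star_one]

/-- The elementary tensors `a ⊗ b`, `a ∈ M`, `b ∈ N`. -/
def elementaryTensors (M : StarSubalgebra ℂ (H →L[ℂ] H)) (N : StarSubalgebra ℂ (K →L[ℂ] K)) :
    Set (HTensor H K →L[ℂ] HTensor H K) :=
  {x | ∃ a ∈ M, ∃ b ∈ N, x = opTensor a b}

/-- The (spatial) tensor product of two C*-algebras of operators: the C*-algebra on the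
tensor product Hilbert space generated by the elementary tensors. -/
def spatialTensor (M : StarSubalgebra ℂ (H →L[ℂ] H)) (N : StarSubalgebra ℂ (K →L[ℂ] K)) :
    StarSubalgebra ℂ (HTensor H K →L[ℂ] HTensor H K) :=
  (StarAlgebra.adjoin ℂ (elementaryTensors M N)).topologicalClosure

/-- The tensor product of two von Neumann algebras: the von Neumann algebra on the
tensor product Hilbert space generated by the elementary tensors, i.e. the bicommutant of
the (self-adjoint) set of elementary tensors. -/
def vnTensor (M : StarSubalgebra ℂ (H →L[ℂ] H)) (N : StarSubalgebra ℂ (K →L[ℂ] K)) :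
    StarSubalgebra ℂ (HTensor H K →L[ℂ] HTensor H K) :=
  StarSubalgebra.centralizer ℂ
    (StarSubalgebra.centralizer ℂ (elementaryTensors M N) : Set (HTensor H K →L[ℂ] HTensor H K))

theorem opTensor_mem_spatial {M : StarSubalgebra ℂ (H →L[ℂ] H)}
    {N : StarSubalgebra ℂ (K →L[ℂ] K)} {a : H →L[ℂ] H} {b : K →L[ℂ] K} (ha : a ∈ M) (hb : b ∈ N) :
    opTensor a b ∈ spatialTensor M N :=
  StarSubalgebra.le_topologicalClosure _ (StarAlgebra.subset_adjoin ℂ _ ⟨a, ha, b, hb, rfl⟩)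

theorem opTensor_mem_vn {M : StarSubalgebra ℂ (H →L[ℂ] H)}
    {N : StarSubalgebra ℂ (K →L[ℂ] K)} {a : H →L[ℂ] H} {b : K →L[ℂ] K} (ha : a ∈ M) (hb : b ∈ N) :
    opTensor a b ∈ vnTensor M N := by
  have hx : opTensor a b ∈ elementaryTensors M N := ⟨a, ha, b, hb, rfl⟩
  rw [vnTensor, StarSubalgebra.mem_centralizer_iff]
  intro g hg
  have hg' : star g ∈ StarSubalgebra.centralizer ℂ (elementaryTensors M N) := star_mem hg
  rw [SetLike.mem_coe, StarSubalgebra.mem_centralizer_iff] at hg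
  rw [StarSubalgebra.mem_centralizer_iff] at hg'
  exact ⟨((hg _ hx).1).symm, ((hg' _ hx).1).symm⟩

end Tensor

/-! ### Entanglement of formation -/

section EoF

variable {H K : Type*} [NormedAddCommGroup H] [InnerProductSpace ℂ H] [CompleteSpace H]
  [NormedAddCommGroup K] [InnerProductSpace ℂ K] [CompleteSpace K]

/-- The restriction map `(r φ)(a) = φ (a ⊗ 1)`, `a ∈ B(H)`, from states of a C*-algebra `A` acting
on `H ⊗ K` and containing `B(H) ⊗ 1` to states of `B(H)`. -/
def restriction (A : StarSubalgebra ℂ (HTensor H K →L[ℂ] HTensor H K))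
    (hA : ∀ a : H →L[ℂ] H, opTensor a (1 : K →L[ℂ] K) ∈ A) (φ : State A) : State (H →L[ℂ] H) :=
  φ.comap (StarAlgHom.codRestrict (leftEmbedding (H := H) (K := K)) A hA) <|
    Continuous.subtype_mk (f := leftEmbedding (H := H) (K := K)) (map_continuous _) hA

theorem restriction_apply (A : StarSubalgebra ℂ (HTensor H K →L[ℂ] HTensor H K))
    (hA : ∀ a : H →L[ℂ] H, opTensor a (1 : K →L[ℂ] K) ∈ A) (φ : State A) (a : H →L[ℂ] H) :
    restriction A hA φ a = φ ⟨opTensor a 1, hA a⟩ := rfl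

/-- The entanglement of formation, with respect to the tensor factor `B(H)`, of a state `ω` of a
C*-algebra `A` acting on `H ⊗ K` and containing `B(H) ⊗ 1`:
the infimum of `∫ S(r φ) dμ(φ)` over all Radon probability measures `μ` on the state space of `A`
with barycenter `ω`. -/
def eof [FiniteDimensional ℂ H] (A : StarSubalgebra ℂ (HTensor H K →L[ℂ] HTensor H K))
    (hA : ∀ a : H →L[ℂ] H, opTensor a (1 : K →L[ℂ] K) ∈ A) (ω : State A) : ℝ :=
  sInf ((fun μ : Measure (State A) => ∫ φ, vonNeumannEntropy (restriction A hA φ) ∂μ) ''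
    measuresWithBarycenter ω)

/-- A normal state of a von Neumann algebra `A ⊆ B(H)`: a state given by a density matrix
`ρ = ∑ n, |ξ n⟩⟨ξ n|` on `H`, so that `φ a = Tr (ρ a) = ∑ n, ⟨ξ n, a (ξ n)⟩`. -/
def IsNormalState {A : StarSubalgebra ℂ (H →L[ℂ] H)} (φ : State A) : Prop :=
  ∃ ξ : ℕ → H, ∀ a : A, HasSum (fun n => inner ℂ (ξ n) ((a : H →L[ℂ] H) (ξ n))) (φ a)

/-- The C*-algebra `B(H) ⊗ M` on `H ⊗ K`. -/
abbrev bipartite (H : Type*) [NormedAddCommGroup H] [InnerProductSpace ℂ H] [CompleteSpace H]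
    (M : StarSubalgebra ℂ (K →L[ℂ] K)) : StarSubalgebra ℂ (HTensor H K →L[ℂ] HTensor H K) :=
  spatialTensor ⊤ M

/-- The C*-algebra `B(H) ⊗ M ⊗ B(H) ⊗ M`, with its factors grouped as
`(B(H) ⊗ B(H)) ⊗ (M ⊗ M)`, where `B(H) ⊗ B(H) = B(H ⊗ H)` as `H` is finite dimensional. -/
abbrev fourfold (H : Type*) [NormedAddCommGroup H] [InnerProductSpace ℂ H] [CompleteSpace H]
    (M : StarSubalgebra ℂ (K →L[ℂ] K)) :
    StarSubalgebra ℂ (HTensor (HTensor H H) (HTensor K K) →L[ℂ]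
      HTensor (HTensor H H) (HTensor K K)) :=
  spatialTensor ⊤ (spatialTensor M M)

/-- The von Neumann algebra `B(H) ⊗ M` on `H ⊗ K`. -/
abbrev bipartiteVN (H : Type*) [NormedAddCommGroup H] [InnerProductSpace ℂ H] [CompleteSpace H]
    (M : VonNeumannAlgebra K) : StarSubalgebra ℂ (HTensor H K →L[ℂ] HTensor H K) :=
  vnTensor ⊤ M.toStarSubalgebra

/-- The von Neumann algebra `B(H) ⊗ M ⊗ B(H) ⊗ M`, with its factors grouped as
`(B(H) ⊗ B(H)) ⊗ (M ⊗ M)`. -/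
abbrev fourfoldVN (H : Type*) [NormedAddCommGroup H] [InnerProductSpace ℂ H] [CompleteSpace H]
    (M : VonNeumannAlgebra K) :
    StarSubalgebra ℂ (HTensor (HTensor H H) (HTensor K K) →L[ℂ]
      HTensor (HTensor H H) (HTensor K K)) :=
  vnTensor ⊤ (vnTensor M.toStarSubalgebra M.toStarSubalgebra)

/-- `Ω` is the product state `ω ⊗ ω` on the C*-algebraic fourfold tensor product. -/
def IsTensorSquare {M : StarSubalgebra ℂ (K →L[ℂ] K)} (ω : State (bipartite H M))
    (Ω : State (fourfold H M)) : Prop :=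
  ∀ (a b : H →L[ℂ] H) (m n : K →L[ℂ] K) (hm : m ∈ M) (hn : n ∈ M),
    Ω ⟨opTensor (opTensor a b) (opTensor m n),
        opTensor_mem_spatial (by trivial) (opTensor_mem_spatial hm hn)⟩
      = ω ⟨opTensor a m, opTensor_mem_spatial (by trivial) hm⟩
        * ω ⟨opTensor b n, opTensor_mem_spatial (by trivial) hn⟩

/-- `Ω` is a product state `ω ⊗ ω` on the von Neumann algebraic fourfold tensor product. -/
def IsTensorSquareVN {M : VonNeumannAlgebra K} (ω : State (bipartiteVN H M))
    (Ω : State (fourfoldVN H M)) : Prop :=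
  ∀ (a b : H →L[ℂ] H) (m n : K →L[ℂ] K) (hm : m ∈ M.toStarSubalgebra)
    (hn : n ∈ M.toStarSubalgebra),
    Ω ⟨opTensor (opTensor a b) (opTensor m n),
        opTensor_mem_vn (by trivial) (opTensor_mem_vn hm hn)⟩
      = ω ⟨opTensor a m, opTensor_mem_vn (by trivial) hm⟩
        * ω ⟨opTensor b n, opTensor_mem_vn (by trivial) hn⟩

variable [FiniteDimensional ℂ H]

/-- The entanglement of formation of a state of `B(H) ⊗ M`. -/
def eofBipartite {M : StarSubalgebra ℂ (K →L[ℂ] K)} (ω : State (bipartite H M)) : ℝ :=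
  eof (bipartite H M) (fun _ => opTensor_mem_spatial (by trivial) (one_mem _)) ω

/-- The entanglement of formation of a state of `B(H) ⊗ M ⊗ B(H) ⊗ M`, the entropy being taken
on `B(H) ⊗ B(H)`. -/
def eofFourfold {M : StarSubalgebra ℂ (K →L[ℂ] K)} (Ω : State (fourfold H M)) : ℝ :=
  eof (fourfold H M) (fun _ => opTensor_mem_spatial (by trivial) (one_mem _)) Ω

/-- The entanglement of formation of a state of the von Neumann algebra `B(H) ⊗ M`. -/
def eofBipartiteVN {M : VonNeumannAlgebra K} (ω : State (bipartiteVN H M)) : ℝ :=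
  eof (bipartiteVN H M) (fun _ => opTensor_mem_vn (by trivial) (one_mem _)) ω

/-- The entanglement of formation of a state of the von Neumann algebra
`B(H) ⊗ M ⊗ B(H) ⊗ M`, the entropy being taken on `B(H) ⊗ B(H)`. -/
def eofFourfoldVN {M : VonNeumannAlgebra K} (Ω : State (fourfoldVN H M)) : ℝ :=
  eof (fourfoldVN H M) (fun _ => opTensor_mem_vn (by trivial) (one_mem _)) Ω

end EoF

end EntForm

end

/-! Suppose `ω = ∑ i, w i • φ i` is a finite convex decomposition. The states `φ i ⊗ φ j` with
weights `w i * w j` then decompose `ω ⊗ ω`. Entropy is additive on products, so the cost of this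
decomposition is `∑ i j, w i w j (S(r φ i) + S(r φ j)) = 2 ∑ i, w i S(r φ i)`. This is the whole
inequality once three points are settled.

Reduction to finite decompositions (`exists_finite_decomposition`). The density matrix of `r φ`
stays in a compact set of matrices, on which the entropy is uniformly continuous. Cut the state
space into finitely many cells on which this matrix varies little, and replace a measure on each
cell by its conditional barycenter. The average entropy rises by at most `ε`. No product of measures
on the state space is then needed, and `eof_le_two_mul` asks only for product states of finitely
many pairs.

Product states on the C*-tensor product (`exists_product_state`). Extend both functionals to all
bounded operators, slice with one and evaluate with the other. On the span of the elementary tensors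
positivity is the Schur product theorem: the Hadamard product of two positive semidefinite Gram
matrices is positive semidefinite. Norm density does the rest, including uniqueness.

Product states on the von Neumann tensor product (`exists_product_stateVN`). Norm density fails, so
normality must replace it. The components of a decomposition need not be assumed normal: `w i • φ i
≤ ω` with `w i > 0` forces `φ i = ∑ n, ⟨η n, · ξ n⟩`, where `ξ` is the family of vectors of `ω`
itself. Products of such functionals are given by products of the vectors. Equalities and positivity
pass from a *-algebra to its bicommutant by the density theorem on an infinite amplification
(`diag_mem_closure`). -/

noncomputable section

namespace EntForm

/-! ### Cauchy–Schwarz and contractivity for states -/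

section StateBounds

variable {A : Type*} [NormedRing A] [NormedAlgebra ℂ A] [StarRing A]

/-- A state as a continuous linear functional. -/
def State.toCLM (φ : State A) : A →L[ℂ] ℂ := WeakDual.toStrongDual φ.1

theorem State.toCLM_apply (φ : State A) (a : A) : φ.toCLM a = φ a := rfl

theorem State.toCLM_one (φ : State A) : φ.toCLM 1 = 1 := φ.2.1

theorem State.toCLM_star_mul_self_nonneg (φ : State A) (a : A) : 0 ≤ φ.toCLM (star a * a) := φ.2.2 a

theorem State.ext {φ ψ : State A} (h : ∀ a, φ.toCLM a = ψ.toCLM a) : φ = ψ :=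
  Subtype.ext (DFunLike.ext _ _ h)

theorem State.continuous_eval (a : A) : Continuous fun φ : State A => φ.toCLM a :=
  (WeakDual.eval_continuous a).comp continuous_subtype_val

/-- The state given by a positive normalized continuous linear functional. -/
def State.ofCLM (f : A →L[ℂ] ℂ) (h1 : f 1 = 1) (hp : ∀ a, 0 ≤ f (star a * a)) : State A :=
  ⟨StrongDual.toWeakDual f, h1, hp⟩

variable [StarModule ℂ A]

theorem State.toCLM_star (φ : State A) (a : A) : φ.toCLM (star a) = star (φ.toCLM a) :=
  φ.map_star a

/-- The Gelfand–Naimark–Segal pre-inner product of a state. -/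
abbrev State.preCore (φ : State A) : PreInnerProductSpace.Core ℂ A where
  inner a b := φ.toCLM (star a * b)
  conj_inner_symm a b := by
    change star (φ.toCLM (star b * a)) = φ.toCLM (star a * b)
    rw [← State.toCLM_star, star_mul, star_star]
  re_inner_nonneg a := (Complex.nonneg_iff.mp (φ.toCLM_star_mul_self_nonneg a)).1
  add_left a b c := by
    change φ.toCLM _ = φ.toCLM _ + φ.toCLM _
    rw [star_add, add_mul, map_add]
  smul_left a b r := by
    change φ.toCLM _ = _ * φ.toCLM _
    rw [star_smul, smul_mul_assoc, map_smul]; rfl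

/-- Cauchy–Schwarz for the Gelfand–Naimark–Segal form. -/
theorem State.norm_apply_star_mul_sq_le (φ : State A) (a b : A) :
    ‖φ.toCLM (star a * b)‖ ^ 2 ≤ (φ.toCLM (star a * a)).re * (φ.toCLM (star b * b)).re := by
  have h := @InnerProductSpace.Core.inner_mul_inner_self_le ℂ A _ _ _ φ.preCore a b
  have e : φ.toCLM (star b * a) = star (φ.toCLM (star a * b)) := by
    rw [← State.toCLM_star, star_mul, star_star]
  change ‖φ.toCLM (star a * b)‖ * ‖φ.toCLM (star b * a)‖ ≤ _ at h
  rw [e, norm_star, ← sq] at h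
  exact h

theorem State.norm_apply_sq_le (φ : State A) (a : A) : ‖φ.toCLM a‖ ^ 2 ≤ (φ.toCLM (star a * a)).re := by
  have h := φ.norm_apply_star_mul_sq_le 1 a
  simpa [φ.toCLM_one] using h

theorem State.norm_apply_pow_le (φ : State A) {h : A} (hh : IsSelfAdjoint h) (n : ℕ) :
    ‖φ.toCLM h‖ ^ (2 ^ n) ≤ ‖φ.toCLM (h ^ (2 ^ n))‖ := by
  induction n with
  | zero => simp
  | succ n ih =>
    calc ‖φ.toCLM h‖ ^ (2 ^ (n + 1)) = (‖φ.toCLM h‖ ^ (2 ^ n)) ^ 2 := by rw [← pow_mul, pow_succ]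
      _ ≤ ‖φ.toCLM (h ^ (2 ^ n))‖ ^ 2 := by gcongr
      _ ≤ (φ.toCLM (star (h ^ (2 ^ n)) * h ^ (2 ^ n))).re := φ.norm_apply_sq_le _
      _ ≤ ‖φ.toCLM (star (h ^ (2 ^ n)) * h ^ (2 ^ n))‖ := Complex.re_le_norm _
      _ = _ := by rw [(hh.pow _).star_eq, ← sq, ← pow_mul, pow_succ]

/-- Continuity gives some bound `C`. Iterating `|φ h|² ≤ |φ (h²)|` turns it into `|φ h| ^ 2^n ≤ C
‖h‖ ^ 2^n` for all `n`, so the constant can be taken to be 1. Neither spectral theory nor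
completeness of `A` enters. -/
theorem State.norm_apply_le_of_isSelfAdjoint (φ : State A) {h : A} (hh : IsSelfAdjoint h) :
    ‖φ.toCLM h‖ ≤ ‖h‖ := by
  obtain ⟨C, hC0, hC⟩ : ∃ C : ℝ, 0 < C ∧ ∀ a, ‖φ.toCLM a‖ ≤ C * ‖a‖ :=
    ⟨‖φ.toCLM‖ + 1, by positivity, fun a =>
      (φ.toCLM.le_opNorm a).trans (by gcongr; linarith)⟩
  by_contra! hlt
  have hpos : 0 < ‖φ.toCLM h‖ := (norm_nonneg _).trans_lt hlt
  have key : ∀ n : ℕ, 1 ≤ C * (‖h‖ / ‖φ.toCLM h‖) ^ (2 ^ n) := fun n => by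
    rw [div_pow, ← mul_div_assoc, le_div_iff₀ (by positivity), one_mul]
    calc ‖φ.toCLM h‖ ^ (2 ^ n) ≤ ‖φ.toCLM (h ^ (2 ^ n))‖ := φ.norm_apply_pow_le hh n
      _ ≤ C * ‖h ^ (2 ^ n)‖ := hC _
      _ ≤ C * ‖h‖ ^ (2 ^ n) := by
        gcongr; exact norm_pow_le' _ (by positivity)
  have hlim : Filter.Tendsto (fun n : ℕ => C * (‖h‖ / ‖φ.toCLM h‖) ^ (2 ^ n)) Filter.atTop
      (nhds (C * 0)) :=
    ((tendsto_pow_atTop_nhds_zero_of_lt_one (by positivity) ((div_lt_one hpos).2 hlt)).comp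
      (tendsto_pow_atTop_atTop_of_one_lt (by norm_num : 1 < 2))).const_mul C
  have := ge_of_tendsto' hlim key
  norm_num at this

/-- States are contractive. -/
theorem State.norm_apply_le [NormedStarGroup A] (φ : State A) (a : A) : ‖φ.toCLM a‖ ≤ ‖a‖ := by
  refine (sq_le_sq₀ (norm_nonneg _) (norm_nonneg _)).mp ?_
  calc ‖φ.toCLM a‖ ^ 2 ≤ (φ.toCLM (star a * a)).re := φ.norm_apply_sq_le a
    _ ≤ ‖φ.toCLM (star a * a)‖ := Complex.re_le_norm _
    _ ≤ ‖star a * a‖ := φ.norm_apply_le_of_isSelfAdjoint (IsSelfAdjoint.star_mul_self a)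
    _ ≤ ‖star a‖ * ‖a‖ := norm_mul_le _ _
    _ = ‖a‖ ^ 2 := by rw [norm_star, sq]

end StateBounds

/-! ### Diagonalization of the density operator -/

section EntropyFacts

variable {H : Type*} [NormedAddCommGroup H] [InnerProductSpace ℂ H] [CompleteSpace H]
  [FiniteDimensional ℂ H]

/-- The density operator of a state. -/
def densityOperator (φ : State (H →L[ℂ] H)) : H →ₗ[ℂ] H :=
  Matrix.toLin (stdOrthonormalBasis ℂ H).toBasis (stdOrthonormalBasis ℂ H).toBasis
    (densityMatrix φ)

/-- The right side mentions no basis, so the entropy can be computed in any orthonormal basis. -/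
theorem inner_densityOperator (φ : State (H →L[ℂ] H)) (x y : H) :
    inner ℂ x (densityOperator φ y) = φ.toCLM (InnerProductSpace.rankOne ℂ y x) := by
  set e := stdOrthonormalBasis ℂ H
  have h1 : ∀ i j, inner ℂ (e i) (densityOperator φ (e j)) =
      φ.toCLM (InnerProductSpace.rankOne ℂ (e j) (e i)) := fun i j => by
    have := Matrix.toLin_self e.toBasis e.toBasis (densityMatrix φ) j
    rw [OrthonormalBasis.coe_toBasis] at this
    rw [densityOperator, this]
    simp [e, densityMatrix, State.toCLM_apply, orthonormal_iff_ite.mp (stdOrthonormalBasis ℂ H).orthonormal]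
  rw [← e.sum_repr' x, ← e.sum_repr' y]
  simp only [map_sum, map_smul, map_smulₛₗ, sum_inner, inner_sum, inner_smul_left, inner_smul_right, h1,
    sum_apply, smul_apply, smul_eq_mul, Finset.mul_sum]
  rw [Finset.sum_comm]
  exact Finset.sum_congr rfl fun i _ => Finset.sum_congr rfl fun j _ => by ring

/-- The eigenvalues with multiplicity are the roots of the characteristic polynomial, which is the
same in the basis `f`, where the density operator is diagonal. -/
theorem vonNeumannEntropy_eq_sum {ι : Type*} [Fintype ι] [DecidableEq ι] (φ : State (H →L[ℂ] H))
    (f : OrthonormalBasis ι ℂ H) (p : ι → ℝ)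
    (h : ∀ i j, φ.toCLM (InnerProductSpace.rankOne ℂ (f j) (f i)) = if i = j then (p i : ℂ) else 0) :
    vonNeumannEntropy φ = ∑ i, Real.negMulLog (p i) := by
  have hD : LinearMap.toMatrix f.toBasis f.toBasis (densityOperator φ) =
      Matrix.diagonal (fun i => (p i : ℂ)) := by
    ext i j
    rw [LinearMap.toMatrix_apply, OrthonormalBasis.coe_toBasis, OrthonormalBasis.coe_toBasis_repr_apply,
      OrthonormalBasis.repr_apply_apply, inner_densityOperator, h, Matrix.diagonal_apply]
  have hc : (densityMatrix φ).charpoly = (Matrix.diagonal (fun i => (p i : ℂ))).charpoly := by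
    rw [← hD, LinearMap.charpoly_toMatrix, densityOperator,
      ← LinearMap.charpoly_toMatrix _ (stdOrthonormalBasis ℂ H).toBasis, LinearMap.toMatrix_toLin]
  have hr := (densityMatrix_isHermitian φ).roots_charpoly_eq_eigenvalues
  rw [hc, Matrix.charpoly_diagonal, Polynomial.roots_prod _ _ (by
      simp [Finset.prod_ne_zero_iff, Polynomial.X_sub_C_ne_zero])] at hr
  simp only [Polynomial.roots_X_sub_C, Multiset.bind_singleton] at hr
  have hs := congrArg (fun s : Multiset ℂ => (s.map fun z => Real.negMulLog z.re).sum) hr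
  simp only [Multiset.map_map, Function.comp_def] at hs
  exact hs.symm

/-- Spectral theorem. The eigenvalues are the values of `φ` on the rank-one eigenprojections, hence
nonnegative, and these projections add up to `1`. -/
theorem exists_diagonalizing_basis (φ : State (H →L[ℂ] H)) :
    ∃ (f : OrthonormalBasis (Fin (Module.finrank ℂ H)) ℂ H) (p : Fin (Module.finrank ℂ H) → ℝ),
      (∀ i, 0 ≤ p i) ∧ ∑ i, p i = 1 ∧
      ∀ i j, φ.toCLM (InnerProductSpace.rankOne ℂ (f j) (f i)) = if i = j then (p i : ℂ) else 0 := by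
  have hs : (densityOperator φ).IsSymmetric := fun x y => by
    rw [← inner_conj_symm, inner_densityOperator, inner_densityOperator]
    change star (φ.toCLM _) = _
    rw [← State.toCLM_star, ContinuousLinearMap.star_eq_adjoint, InnerProductSpace.adjoint_rankOne]
  have hd : ∀ i j, φ.toCLM (InnerProductSpace.rankOne ℂ (hs.eigenvectorBasis rfl j)
      (hs.eigenvectorBasis rfl i)) = if i = j then (hs.eigenvalues rfl i : ℂ) else 0 := fun i j => by
    rw [← inner_densityOperator, LinearMap.IsSymmetric.apply_eigenvectorBasis, inner_smul_right,
      orthonormal_iff_ite.mp (hs.eigenvectorBasis rfl).orthonormal]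
    split_ifs with hij
    · subst hij; simp
    · simp
  refine ⟨hs.eigenvectorBasis rfl, hs.eigenvalues rfl, fun i => ?_, ?_, hd⟩
  · have h1 := hd i i
    have h2 := φ.toCLM_star_mul_self_nonneg (InnerProductSpace.rankOne ℂ (hs.eigenvectorBasis rfl i)
      (hs.eigenvectorBasis rfl i))
    have h3 : star (InnerProductSpace.rankOne ℂ (hs.eigenvectorBasis rfl i)
      (hs.eigenvectorBasis rfl i)) * (InnerProductSpace.rankOne ℂ (hs.eigenvectorBasis rfl i)
      (hs.eigenvectorBasis rfl i)) = (InnerProductSpace.rankOne ℂ (hs.eigenvectorBasis rfl i)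
      (hs.eigenvectorBasis rfl i)) := by
      rw [ContinuousLinearMap.star_eq_adjoint, InnerProductSpace.adjoint_rankOne]
      ext x
      simp
    rw [h3] at h2
    rw [if_pos rfl] at h1
    rw [h1] at h2
    exact_mod_cast h2
  · have h1 : (1 : H →L[ℂ] H) = ∑ i, InnerProductSpace.rankOne ℂ (hs.eigenvectorBasis rfl i)
      (hs.eigenvectorBasis rfl i) := by
      ext x
      simp [OrthonormalBasis.sum_repr']
    have h2 := φ.toCLM_one
    simp only [h1, map_sum, hd, if_true] at h2
    exact_mod_cast h2

theorem vonNeumannEntropy_nonneg (φ : State (H →L[ℂ] H)) : 0 ≤ vonNeumannEntropy φ := by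
  obtain ⟨f, p, hp, hs, h⟩ := exists_diagonalizing_basis φ
  rw [vonNeumannEntropy_eq_sum φ f p h]
  refine Finset.sum_nonneg fun i _ => Real.negMulLog_nonneg (hp i) ?_
  rw [← hs]
  exact Finset.single_le_sum (fun j _ => hp j) (Finset.mem_univ i)

end EntropyFacts

/-! ### Continuity of the functional calculus under the trace -/

section EntropyContinuity

open scoped Matrix.Norms.L2Operator

/-- The spectra of a bounded set of matrices lie in one compact interval, over which the functional
calculus is continuous in the operator. -/
theorem continuousOn_trace_cfc {n : Type*} [Fintype n] [DecidableEq n] (g : ℝ → ℝ)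
    (hg : Continuous g) {K : Set (Matrix n n ℂ)} (hK : IsCompact K)
    (hsa : ∀ a ∈ K, a.IsHermitian) : ContinuousOn (fun a => (cfc g a).trace) K := by
  obtain ⟨R, hR⟩ := hK.isBounded.exists_norm_le
  have hc : ContinuousOn (cfc g : Matrix n n ℂ → Matrix n n ℂ) K := by
    refine (continuousOn_cfc (𝕜 := ℝ) (Matrix n n ℂ)
      (isCompact_closedBall (0 : ℝ) (R * ‖(1 : Matrix n n ℂ)‖)) g hg.continuousOn).mono ?_
    intro a ha
    refine ⟨(hsa a ha).isSelfAdjoint, fun t ht => ?_⟩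
    rw [mem_closedBall_zero_iff]
    exact (spectrum.norm_le_norm_mul_of_mem ht).trans (by gcongr; exact hR a ha)
  exact (Continuous.matrix_trace continuous_id).comp_continuousOn hc

theorem Matrix.IsHermitian.trace_cfc {n : Type*} [Fintype n] [DecidableEq n] {a : Matrix n n ℂ}
    (ha : a.IsHermitian) (g : ℝ → ℝ) : (cfc g a).trace = ∑ i, (g (ha.eigenvalues i) : ℂ) := by
  rw [Matrix.IsHermitian.cfc_eq ha, Matrix.IsHermitian.cfc, Unitary.conjStarAlgAut_apply,
    Matrix.trace_mul_comm, ← mul_assoc]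
  simp [Matrix.trace]

end EntropyContinuity

/-! ### Continuity and additivity of the entropy -/

section EntropyState

variable {H : Type*} [NormedAddCommGroup H] [InnerProductSpace ℂ H] [CompleteSpace H]
  [FiniteDimensional ℂ H]

theorem norm_densityMatrix_apply_le (φ : State (H →L[ℂ] H)) (i j) : ‖densityMatrix φ i j‖ ≤ 1 := by
  refine (φ.norm_apply_le _).trans ?_
  simp [InnerProductSpace.norm_rankOne]

/-- The entropy is a uniformly continuous function of the entries of the density matrix. -/
theorem vonNeumannEntropy_uniform (H : Type*) [NormedAddCommGroup H] [InnerProductSpace ℂ H]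
    [CompleteSpace H] [FiniteDimensional ℂ H] {ε : ℝ} (hε : 0 < ε) :
    ∃ δ > 0, ∀ φ ψ : State (H →L[ℂ] H),
      (∀ i j, ‖densityMatrix φ i j - densityMatrix ψ i j‖ < δ) →
      |vonNeumannEntropy φ - vonNeumannEntropy ψ| < ε := by
  set n := Fin (Module.finrank ℂ H)
  -- All density matrices lie in this compact set, so continuity on it is already uniform.
  let K : Set (n → n → ℂ) := (Set.univ.pi fun _ => Set.univ.pi fun _ => Metric.closedBall 0 1) ∩
    {a | (Matrix.of a).IsHermitian}
  have hK : IsCompact K := by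
    refine IsCompact.inter_right
      (isCompact_univ_pi fun _ => isCompact_univ_pi fun _ => isCompact_closedBall 0 1) ?_
    exact isClosed_eq (Continuous.matrix_conjTranspose (A := fun a : n → n → ℂ => Matrix.of a)
      continuous_id) continuous_id
  have hmem : ∀ φ : State (H →L[ℂ] H), (fun i j => densityMatrix φ i j) ∈ K := fun φ => by
    refine ⟨fun i _ j _ => ?_, densityMatrix_isHermitian φ⟩
    simpa using norm_densityMatrix_apply_le φ i j
  have hcont := continuousOn_trace_cfc Real.negMulLog Real.continuous_negMulLog
    (K := (K : Set (Matrix n n ℂ))) hK (fun a ha => ha.2)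
  have hu := hK.uniformContinuousOn_of_continuous (f := fun a : n → n → ℂ =>
    (cfc Real.negMulLog (Matrix.of a)).trace) hcont
  obtain ⟨δ, hδ, h⟩ := Metric.uniformContinuousOn_iff.mp hu ε hε
  refine ⟨δ, hδ, fun φ ψ hd => ?_⟩
  have h1 := h _ (hmem φ) _ (hmem ψ) ((dist_pi_lt_iff hδ).2 fun i => (dist_pi_lt_iff hδ).2 fun j => by
    rw [dist_eq_norm]; exact hd i j)
  have h2 : ∀ φ : State (H →L[ℂ] H), (cfc Real.negMulLog (Matrix.of fun i j => densityMatrix φ i j)).trace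
      = (vonNeumannEntropy φ : ℂ) := fun φ => by
    rw [vonNeumannEntropy, Complex.ofReal_sum]
    exact Matrix.IsHermitian.trace_cfc (densityMatrix_isHermitian φ) _
  rw [h2, h2, dist_eq_norm, ← Complex.ofReal_sub, Complex.norm_real] at h1
  exact h1

theorem continuous_densityMatrix_apply (i j) :
    Continuous fun φ : State (H →L[ℂ] H) => densityMatrix φ i j :=
  State.continuous_eval _

theorem continuous_vonNeumannEntropy :
    Continuous (vonNeumannEntropy : State (H →L[ℂ] H) → ℝ) := by
  rw [continuous_iff_continuousAt]
  intro φ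
  rw [ContinuousAt, Metric.tendsto_nhds]
  intro ε hε
  obtain ⟨δ, hδ, h⟩ := vonNeumannEntropy_uniform H hε
  have : ∀ᶠ ψ in nhds φ, ∀ i j, ‖densityMatrix ψ i j - densityMatrix φ i j‖ < δ := by
    rw [Filter.eventually_all]; intro i
    rw [Filter.eventually_all]; intro j
    have := Metric.tendsto_nhds.mp ((continuous_densityMatrix_apply i j).tendsto φ) δ hδ
    filter_upwards [this] with ψ hψ using by rwa [← dist_eq_norm]
  filter_upwards [this] with ψ hψ using h ψ φ hψ

/-- In finite dimension the algebraic tensor product is already complete. -/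
theorem HTensor.incl_surjective (H : Type*) [NormedAddCommGroup H] [InnerProductSpace ℂ H]
    [FiniteDimensional ℂ H] : Function.Surjective (HTensor.incl H H) := by
  have : CompleteSpace (H ⊗[ℂ] H) := FiniteDimensional.complete ℂ _
  have hr : IsClosed (Set.range (HTensor.incl H H)) :=
    (HTensor.incl H H).isometry.isUniformInducing.isComplete_range.isClosed
  rw [← Set.range_eq_univ, ← hr.closure_eq]
  exact (HTensor.denseRange_incl H H).closure_eq

/-- The product orthonormal basis. -/
def HTensor.orthonormalBasis {ι κ : Type*} [Fintype ι] [Fintype κ]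
    (f : OrthonormalBasis ι ℂ H) (g : OrthonormalBasis κ ℂ H) :
    OrthonormalBasis (ι × κ) ℂ (HTensor H H) :=
  (f.tensorProduct g).map
    (LinearIsometryEquiv.ofSurjective (HTensor.incl H H) (HTensor.incl_surjective H))

omit [CompleteSpace H] in
theorem HTensor.orthonormalBasis_apply {ι κ : Type*} [Fintype ι] [Fintype κ]
    (f : OrthonormalBasis ι ℂ H) (g : OrthonormalBasis κ ℂ H) (k : ι × κ) :
    HTensor.orthonormalBasis f g k = HTensor.tmul (f k.1) (g k.2) := by
  simp [HTensor.orthonormalBasis, OrthonormalBasis.tensorProduct_apply', HTensor.tmul]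

theorem HTensor.inner_tmul {H K : Type*} [NormedAddCommGroup H] [InnerProductSpace ℂ H]
    [NormedAddCommGroup K] [InnerProductSpace ℂ K] (x z : H) (y w : K) :
    inner ℂ (HTensor.tmul x y) (HTensor.tmul z w) = inner ℂ x z * inner ℂ y w := by
  rw [HTensor.tmul, HTensor.tmul, LinearIsometry.inner_map_map, TensorProduct.inner_tmul]

theorem rankOne_tmul {H K : Type*} [NormedAddCommGroup H] [InnerProductSpace ℂ H]
    [NormedAddCommGroup K] [InnerProductSpace ℂ K] (x z : H) (y w : K) :
    InnerProductSpace.rankOne ℂ (HTensor.tmul x y) (HTensor.tmul z w) =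
      opTensor (InnerProductSpace.rankOne ℂ x z) (InnerProductSpace.rankOne ℂ y w) := by
  refine op_ext fun u v => ?_
  rw [InnerProductSpace.rankOne_apply, opTensor_tmul, HTensor.inner_tmul,
    InnerProductSpace.rankOne_apply, InnerProductSpace.rankOne_apply]
  simp only [HTensor.tmul]
  rw [← TensorProduct.smul_tmul', TensorProduct.tmul_smul, smul_smul, map_smul]

/-- The entropy is additive on product states. -/
theorem vonNeumannEntropy_tensor (φ ψ : State (H →L[ℂ] H))
    (χ : State (HTensor H H →L[ℂ] HTensor H H))
    (h : ∀ a b, χ.toCLM (opTensor a b) = φ.toCLM a * ψ.toCLM b) :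
    vonNeumannEntropy χ = vonNeumannEntropy φ + vonNeumannEntropy ψ := by
  obtain ⟨f, p, hp, hps, hf⟩ := exists_diagonalizing_basis φ
  obtain ⟨g, q, hq, hqs, hg⟩ := exists_diagonalizing_basis ψ
  -- The product of the two eigenbases diagonalizes `χ` with eigenvalues `p i * q j`; the logarithm
  -- splits and the remaining factors sum to 1.
  rw [vonNeumannEntropy_eq_sum χ (HTensor.orthonormalBasis f g) (fun k => p k.1 * q k.2),
    vonNeumannEntropy_eq_sum φ f p hf, vonNeumannEntropy_eq_sum ψ g q hg, Fintype.sum_prod_type]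
  · simp only [Real.negMulLog_mul, Finset.sum_add_distrib, ← Finset.sum_mul, ← Finset.mul_sum, hqs,
      hps, one_mul]
  · intro k l
    rw [HTensor.orthonormalBasis_apply, HTensor.orthonormalBasis_apply, rankOne_tmul, h, hf, hg]
    by_cases h1 : k.1 = l.1 <;> by_cases h2 : k.2 = l.2 <;> simp [h1, h2, Prod.ext_iff]

omit [CompleteSpace H] in
/-- On a finite-dimensional space, the elementary tensors of operators span all operators. -/
theorem span_opTensor_eq_top : Submodule.span ℂ
    (Set.range fun p : (H →L[ℂ] H) × (H →L[ℂ] H) => opTensor p.1 p.2) = ⊤ := by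
  rw [eq_top_iff]
  rintro c -
  set f := stdOrthonormalBasis ℂ H
  set e := HTensor.orthonormalBasis f f with he
  have hc : c = ∑ i, ∑ j, inner ℂ (e j) (c (e i)) •
      InnerProductSpace.rankOne ℂ (e j) (e i) := by
    ext x
    simp only [sum_apply, smul_apply, InnerProductSpace.rankOne_apply]
    conv_lhs => rw [← e.sum_repr' x, map_sum]
    refine Finset.sum_congr rfl fun i _ => ?_
    rw [map_smul]
    conv_lhs => rw [← e.sum_repr' (c (e i)), Finset.smul_sum]
    exact Finset.sum_congr rfl fun j _ => smul_comm _ _ _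
  rw [hc]
  refine Submodule.sum_mem _ fun i _ => Submodule.sum_mem _ fun j _ => Submodule.smul_mem _ _ ?_
  rw [he, HTensor.orthonormalBasis_apply, HTensor.orthonormalBasis_apply, rankOne_tmul]
  exact Submodule.subset_span ⟨(_, _), rfl⟩

end EntropyState

/-! ### Finitely supported Radon measures -/

instance {A : Type*} [NormedRing A] [NormedAlgebra ℂ A] [StarRing A] : T2Space (State A) :=
  inferInstanceAs (T2Space {φ : WeakDual ℂ A // φ 1 = 1 ∧ ∀ a : A, 0 ≤ φ (star a * a)})

theorem innerRegular_dirac {X : Type*} [TopologicalSpace X] [MeasurableSpace X] [BorelSpace X]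
    [T1Space X] (x : X) : (Measure.dirac x).InnerRegular := by
  refine ⟨fun U hU r hr => ?_⟩
  have hx : x ∈ U := by
    by_contra hx
    simp [Measure.dirac_apply' x hU, hx] at hr
  exact ⟨{x}, by simpa using hx, isCompact_singleton,
    hr.trans_le (by rw [Measure.dirac_apply_of_mem (Set.mem_singleton x)]; exact prob_le_one)⟩

section DiscreteMeasure

variable {X κ : Type*} [TopologicalSpace X] [MeasurableSpace X] [BorelSpace X] [T2Space X]
  [Fintype κ]

/-- The finitely supported measure with weights `w` at the points `x`. -/
def discreteMeasure (w : κ → ℝ) (x : κ → X) : Measure X :=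
  ∑ k, ENNReal.ofReal (w k) • Measure.dirac (x k)

omit [TopologicalSpace X] [BorelSpace X] [T2Space X] in
theorem isProbabilityMeasure_discreteMeasure {w : κ → ℝ} (x : κ → X) (hw : ∀ k, 0 ≤ w k)
    (hs : ∑ k, w k = 1) : IsProbabilityMeasure (discreteMeasure w x) := by
  refine ⟨?_⟩
  simp only [discreteMeasure, Measure.coe_finsetSum, Finset.sum_apply, Measure.smul_apply,
    measure_univ, smul_eq_mul, mul_one]
  rw [← ENNReal.ofReal_sum_of_nonneg fun k _ => hw k, hs, ENNReal.ofReal_one]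

theorem regular_discreteMeasure {w : κ → ℝ} (x : κ → X) (hw : ∀ k, 0 ≤ w k)
    (hs : ∑ k, w k = 1) : (discreteMeasure w x).Regular := by
  have := isProbabilityMeasure_discreteMeasure x hw hs
  have : ∀ k, (ENNReal.ofReal (w k) • Measure.dirac (x k)).InnerRegular := fun k => by
    have := innerRegular_dirac (x k)
    infer_instance
  have : (discreteMeasure w x).InnerRegular := by
    rw [discreteMeasure]; infer_instance
  infer_instance

theorem integral_discreteMeasure {E : Type*} [NormedAddCommGroup E] [NormedSpace ℝ E]
    [CompleteSpace E] {w : κ → ℝ} (x : κ → X)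
    (hw : ∀ k, 0 ≤ w k) (f : X → E) :
    ∫ y, f y ∂(discreteMeasure w x) = ∑ k, w k • f (x k) := by
  rw [discreteMeasure, integral_finsetSum_measure fun k _ =>
    (integrable_dirac (by simp)).smul_measure ENNReal.ofReal_ne_top]
  simp [integral_smul_measure, hw]

end DiscreteMeasure

/-! ### Barycenters of measures on the state space -/

section Averages

variable {A : Type*} [NormedRing A] [NormedAlgebra ℂ A] [StarRing A] [StarModule ℂ A]
  [NormedStarGroup A]

theorem integrable_state_apply (μ : Measure (State A)) [IsFiniteMeasure μ] (a : A) :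
    Integrable (fun φ : State A => φ.toCLM a) μ :=
  Integrable.of_bound (State.continuous_eval a).aestronglyMeasurable ‖a‖
    (Filter.Eventually.of_forall fun φ => φ.norm_apply_le a)

/-- The barycenter of a probability measure on the state space. -/
def averageState (μ : Measure (State A)) [IsProbabilityMeasure μ] : State A :=
  State.ofCLM
    (LinearMap.mkContinuous
      { toFun := fun a => ∫ φ : State A, φ.toCLM a ∂μ
        map_add' := fun a b => by
          simp only [map_add]
          exact integral_add (integrable_state_apply μ a) (integrable_state_apply μ b)
        map_smul' := fun c a => by
          simp only [map_smul]
          exact integral_smul c _ } 1 fun a => by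
      refine (norm_integral_le_of_norm_le_const
        (Filter.Eventually.of_forall fun φ : State A => φ.norm_apply_le a)).trans ?_
      simp)
    (by
      change ∫ φ : State A, φ.toCLM 1 ∂μ = 1
      simp [State.toCLM_one])
    (fun a => by
      change 0 ≤ ∫ φ : State A, φ.toCLM (star a * a) ∂μ
      have hre : ∀ φ : State A, φ.toCLM (star a * a) = ((φ.toCLM (star a * a)).re : ℂ) := fun φ =>
        Complex.ext rfl (Complex.nonneg_iff.mp (φ.toCLM_star_mul_self_nonneg a)).2.symm
      rw [integral_congr_ae (Filter.Eventually.of_forall hre), integral_complex_ofReal]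
      exact_mod_cast integral_nonneg fun φ : State A =>
        (Complex.nonneg_iff.mp (φ.toCLM_star_mul_self_nonneg a)).1)

end Averages

/-! ### Approximation of barycentric decompositions by finite ones -/

section Decomposition

variable {H : Type*} [NormedAddCommGroup H] [InnerProductSpace ℂ H] [CompleteSpace H]
  [FiniteDimensional ℂ H]

/-- A crude bound, sufficient for integrability: `-p log p ≤ 1 - p ≤ 1` for each eigenvalue. -/
theorem vonNeumannEntropy_le (φ : State (H →L[ℂ] H)) :
    vonNeumannEntropy φ ≤ Module.finrank ℂ H := by
  obtain ⟨f, p, hp, -, h⟩ := exists_diagonalizing_basis φ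
  rw [vonNeumannEntropy_eq_sum φ f p h]
  refine (Finset.sum_le_card_nsmul Finset.univ _ 1 fun i _ => ?_).trans (by simp)
  rcases (hp i).eq_or_lt with h0 | h0
  · simp [← h0]
  · have h1 := mul_le_mul_of_nonneg_left (Real.one_sub_inv_le_log_of_pos h0) (hp i)
    rw [mul_sub, mul_inv_cancel₀ h0.ne'] at h1
    rw [Real.negMulLog]
    linarith

variable {A : Type*} [NormedRing A] [NormedAlgebra ℂ A] [StarRing A]

theorem continuous_comap {B : Type*} [NormedRing B] [NormedAlgebra ℂ B] [StarRing B]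
    (f : A →⋆ₐ[ℂ] B) (hf : Continuous f) : Continuous (State.comap f hf) :=
  Continuous.subtype_mk (WeakDual.continuous_of_continuous_eval fun a =>
    State.continuous_eval (f a)) _

theorem integrable_entropy {r : State A → State (H →L[ℂ] H)} (hr : Continuous r)
    (μ : Measure (State A)) [IsFiniteMeasure μ] :
    Integrable (fun φ => vonNeumannEntropy (r φ)) μ :=
  Integrable.of_bound (continuous_vonNeumannEntropy.comp hr).aestronglyMeasurable
    (Module.finrank ℂ H) (Filter.Eventually.of_forall fun φ => by
      rw [Real.norm_of_nonneg (vonNeumannEntropy_nonneg _)]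
      exact vonNeumannEntropy_le _)

/-- Finitely many points of a dense sequence form a `δ / 2`-net of `K`; the cells collect the `x`
for which `d x` has the same nearest point. -/
theorem exists_measurable_partition {X E : Type*} [MeasurableSpace X] [PseudoMetricSpace E]
    [MeasurableSpace E] [OpensMeasurableSpace E] [TopologicalSpace.SeparableSpace E] [Nonempty E]
    {d : X → E} (hd : Measurable d) {K : Set E} (hK : IsCompact K) (hdK : ∀ x, d x ∈ K)
    {δ : ℝ} (hδ : 0 < δ) :
    ∃ (N : ℕ) (j : X → Fin N), Measurable j ∧ ∀ x y, j x = j y → dist (d x) (d y) < δ := by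
  set e := TopologicalSpace.denseSeq E
  obtain ⟨t, ht⟩ := hK.elim_finite_subcover (fun k => Metric.ball (e k) (δ / 2))
    (fun k => Metric.isOpen_ball) fun z _ => by
      obtain ⟨k, hk⟩ := (TopologicalSpace.denseRange_denseSeq E).exists_dist_lt z (half_pos hδ)
      exact Set.mem_iUnion.2 ⟨k, hk⟩
  set N := t.sup id
  have hclose : ∀ z ∈ K, edist (SimpleFunc.nearestPt e N z) z < ENNReal.ofReal (δ / 2) := by
    intro z hz
    obtain ⟨k, hk, hzk⟩ := Set.mem_iUnion₂.1 (ht hz)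
    refine (SimpleFunc.edist_nearestPt_le e z (Finset.le_sup (f := id) hk)).trans_lt ?_
    rw [edist_comm, edist_dist]
    exact (ENNReal.ofReal_lt_ofReal_iff (half_pos hδ)).2 hzk
  -- `N` is the largest index used in the cover, and the nearest point is sought among the indices
  -- `0, …, N`.
  refine ⟨N + 1, fun x => ⟨SimpleFunc.nearestPtInd e N (d x),
    Nat.lt_succ_of_le (SimpleFunc.nearestPtInd_le e N _)⟩, ?_, fun x y hxy => ?_⟩
  · refine measurable_to_countable' fun k => ?_
    have := ((SimpleFunc.nearestPtInd e N).measurable.comp hd) (measurableSet_singleton (k : ℕ))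
    convert this using 1
    ext x
    simp [Fin.ext_iff]
  · have hxy' : SimpleFunc.nearestPt e N (d x) = SimpleFunc.nearestPt e N (d y) := by
      change e _ = e _
      rw [Fin.mk.inj_iff.mp hxy]
    have h1 := hclose _ (hdK x)
    have h2 := hclose _ (hdK y)
    rw [edist_dist, ENNReal.ofReal_lt_ofReal_iff (half_pos hδ)] at h1 h2
    rw [hxy'] at h1
    have := dist_triangle_left (d x) (d y) (SimpleFunc.nearestPt e N (d y))
    linarith

theorem sum_setIntegral_fiber {X E : Type*} [MeasurableSpace X] [NormedAddCommGroup E]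
    [NormedSpace ℝ E] {μ : Measure X} {N : ℕ} {j : X → Fin N} (hj : Measurable j) {f : X → E}
    (hf : Integrable f μ) : ∑ k, ∫ x in j ⁻¹' {k}, f x ∂μ = ∫ x, f x ∂μ := by
  rw [← integral_iUnion_fintype (fun k => hj (measurableSet_singleton k))
    (fun k l hkl => by
      exact Disjoint.preimage _ (by simpa using hkl)) fun k => hf.integrableOn]
  have : (⋃ k, j ⁻¹' {k}) = Set.univ := by ext x; simp
  rw [this, setIntegral_univ]

variable [StarModule ℂ A] [NormedStarGroup A]

/-- Every barycentric decomposition of a state is approximated, as far as the entropy of the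
restrictions is concerned, by a finite convex decomposition. -/
theorem exists_finite_decomposition (f : (H →L[ℂ] H) →⋆ₐ[ℂ] A) (hf : Continuous f) {ω : State A}
    {μ : Measure (State A)} (hμ : μ ∈ measuresWithBarycenter ω) {ε : ℝ} (hε : 0 < ε) :
    ∃ (ι : Type) (_ : Fintype ι) (w : ι → ℝ) (φ : ι → State A), (∀ i, 0 < w i) ∧ ∑ i, w i = 1 ∧
      (∀ a, ∑ i, (w i : ℂ) * (φ i).toCLM a = ω.toCLM a) ∧
      ∑ i, w i * vonNeumannEntropy ((φ i).comap f hf) ≤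
        (∫ φ, vonNeumannEntropy (φ.comap f hf) ∂μ) + ε := by
  obtain ⟨hprob, -, hbar⟩ := hμ
  obtain ⟨δ, hδ, hunif⟩ := vonNeumannEntropy_uniform H hε
  set r : State A → State (H →L[ℂ] H) := State.comap f hf
  have hr : Continuous r := continuous_comap f hf
  set n := Fin (Module.finrank ℂ H)
  let d : State A → n → n → ℂ := fun φ i j => densityMatrix (r φ) i j
  have hd : Continuous d := continuous_pi fun i => continuous_pi fun j =>
    (continuous_densityMatrix_apply i j).comp hr
  obtain ⟨N, j, hj, hclose⟩ := exists_measurable_partition hd.measurable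
    (isCompact_univ_pi fun _ : n => isCompact_univ_pi fun _ : n => isCompact_closedBall (0 : ℂ) 1)
    (fun φ i _ j _ => by simpa using norm_densityMatrix_apply_le (r φ) i j) (half_pos hδ)
  have hent := integrable_entropy hr μ
  let P : Fin N → Set (State A) := fun k => j ⁻¹' {k}
  -- Null cells are dropped so that conditioning makes sense and all weights are strictly positive,
  -- as the domination argument for normal states requires.
  let s : Finset (Fin N) := Finset.univ.filter fun k => μ (P k) ≠ 0
  have hμP : ∀ k : s, μ (P k) ≠ 0 := fun k => (Finset.mem_filter.mp k.2).2
  have hcond : ∀ k : s, IsProbabilityMeasure (ProbabilityTheory.cond μ (P k)) := fun k =>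
    ProbabilityTheory.cond_isProbabilityMeasure (hμP k)
  have hint : ∀ {E : Type} [NormedAddCommGroup E] [NormedSpace ℝ E] [CompleteSpace E] (k : s) (g : State A → E),
      (μ.real (P k)) • ∫ φ, g φ ∂(ProbabilityTheory.cond μ (P k)) = ∫ φ in P k, g φ ∂μ := by
    intro E _ _ _ k g
    rw [ProbabilityTheory.cond, integral_smul_measure, smul_smul, ENNReal.toReal_inv,
      ← measureReal_def, mul_inv_cancel₀, one_smul]
    exact (ENNReal.toReal_pos (hμP k) (measure_ne_top μ _)).ne'
  have hsum : ∀ {E : Type} [NormedAddCommGroup E] [NormedSpace ℝ E] [CompleteSpace E] {g : State A → E},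
      Integrable g μ → ∑ k : s, ∫ φ in P k, g φ ∂μ = ∫ φ, g φ ∂μ := by
    intro E _ _ _ g hg
    rw [Finset.sum_coe_sort s fun k => ∫ φ in P k, g φ ∂μ, ← sum_setIntegral_fiber hj hg]
    refine Finset.sum_filter_of_ne fun k _ hk h0 => hk ?_
    rw [Measure.restrict_eq_zero.2 h0, integral_zero_measure]
  have hsumw : ∑ k : s, μ.real (P k) = 1 := by
    have := hsum (integrable_const (μ := μ) (1 : ℝ))
    simpa using this
  let ψ : s → State A := fun k => averageState (ProbabilityTheory.cond μ (P k))
  -- Density matrix entries are affine in the state, so those of the barycenter are averages over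
  -- the cell. They stay within `δ / 2 < δ` of those of each state in the cell.
  have hent_le : ∀ (k : s), ∀ φ ∈ P k, vonNeumannEntropy (r (ψ k)) ≤ vonNeumannEntropy (r φ) + ε := by
    intro k φ hφ
    have hlt := hunif (r (ψ k)) (r φ) fun i l => ?_
    · have := (abs_lt.mp hlt).2
      linarith
    have h1 : densityMatrix (r (ψ k)) i l =
        ∫ χ, densityMatrix (r χ) i l ∂(ProbabilityTheory.cond μ (P k)) := rfl
    have h2 : densityMatrix (r φ) i l =
        ∫ χ, densityMatrix (r φ) i l ∂(ProbabilityTheory.cond μ (P k)) := by simp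
    have h0 : Integrable (fun χ => densityMatrix (r χ) i l) (ProbabilityTheory.cond μ (P k)) :=
      integrable_state_apply _ _
    have hsub := integral_sub h0 (integrable_const (densityMatrix (r φ) i l))
    rw [h1, h2, ← hsub]
    refine (norm_integral_le_of_norm_le_const (C := δ / 2) ?_).trans_lt (by simp; linarith)
    filter_upwards [ProbabilityTheory.ae_cond_mem (hj (measurableSet_singleton (k : Fin N)))] with χ hχ
    have h3 : j χ = j φ := (show j χ = k from hχ).trans (show j φ = k from hφ).symm
    have h4 := hclose χ φ h3
    rw [dist_pi_lt_iff (half_pos hδ)] at h4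
    have h5 := h4 i
    rw [dist_pi_lt_iff (half_pos hδ)] at h5
    rw [← dist_eq_norm]
    exact (h5 l).le
  refine ⟨s, inferInstance, fun k => μ.real (P k), ψ, fun k =>
    ENNReal.toReal_pos (hμP k) (measure_ne_top μ _), hsumw, fun a => ?_, ?_⟩
  · rw [State.toCLM_apply ω, ← hbar a]
    refine Eq.trans (Finset.sum_congr rfl fun k _ => ?_) (hsum (integrable_state_apply μ a))
    rw [← hint k, Complex.real_smul]
    rfl
  · calc ∑ k : s, μ.real (P k) * vonNeumannEntropy (r (ψ k))
        = ∑ k : s, ∫ φ in P k, vonNeumannEntropy (r (ψ k)) ∂μ := by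
          refine Finset.sum_congr rfl fun k _ => ?_
          rw [setIntegral_const, smul_eq_mul]
      _ ≤ ∑ k : s, ∫ φ in P k, (vonNeumannEntropy (r φ) + ε) ∂μ := by
          refine Finset.sum_le_sum fun k _ => ?_
          exact setIntegral_mono_on (integrable_const _).integrableOn
            (hent.add (integrable_const _)).integrableOn
            (hj (measurableSet_singleton (k : Fin N))) (hent_le k)
      _ = _ := by
          have hε' : Integrable (fun _ : State A => ε) μ := integrable_const _
          refine (hsum (hent.add hε')).trans ?_
          refine (integral_add hent hε').trans ?_
          simp

end Decomposition

/-! ### Reduction of the inequality to product decompositions -/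

section Subadditivity

variable {H K L : Type*} [NormedAddCommGroup H] [InnerProductSpace ℂ H] [CompleteSpace H]
  [FiniteDimensional ℂ H] [NormedAddCommGroup K] [InnerProductSpace ℂ K] [CompleteSpace K]
  [NormedAddCommGroup L] [InnerProductSpace ℂ L] [CompleteSpace L]

theorem measuresWithBarycenter_nonempty {A : Type*} [NormedRing A] [NormedAlgebra ℂ A] [StarRing A]
    (ω : State A) : (measuresWithBarycenter ω).Nonempty := by
  refine ⟨Measure.dirac ω, inferInstance, ?_, fun a => integral_dirac _ _⟩
  have := innerRegular_dirac ω
  infer_instance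

theorem eof_le_sum (A : StarSubalgebra ℂ (HTensor H K →L[ℂ] HTensor H K))
    (hA : ∀ a : H →L[ℂ] H, opTensor a (1 : K →L[ℂ] K) ∈ A) {κ : Type*} [Fintype κ] {w : κ → ℝ}
    {Φ : κ → State A} {Ω : State A} (hw : ∀ k, 0 ≤ w k) (hs : ∑ k, w k = 1)
    (hΩ : ∀ x, ∑ k, (w k : ℂ) * (Φ k).toCLM x = Ω.toCLM x) :
    eof A hA Ω ≤ ∑ k, w k * vonNeumannEntropy (restriction A hA (Φ k)) := by
  -- Nonnegativity of the entropy makes the real `sInf` a genuine lower bound.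
  have hbdd : BddBelow ((fun μ : Measure (State A) =>
      ∫ φ, vonNeumannEntropy (restriction A hA φ) ∂μ) '' measuresWithBarycenter Ω) :=
    ⟨0, by rintro _ ⟨μ, -, rfl⟩; exact integral_nonneg fun φ => vonNeumannEntropy_nonneg _⟩
  refine (csInf_le hbdd ⟨discreteMeasure w Φ, ⟨isProbabilityMeasure_discreteMeasure Φ hw hs,
    regular_discreteMeasure Φ hw hs, fun x => ?_⟩, rfl⟩).trans_eq ?_
  · rw [integral_discreteMeasure Φ hw, ← State.toCLM_apply, ← hΩ x]
    exact Finset.sum_congr rfl fun k _ => Complex.real_smul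
  · exact integral_discreteMeasure Φ hw _

theorem sum_mul_mul_add {ι : Type*} [Fintype ι] {w : ι → ℝ} (hs : ∑ i, w i = 1) (t : ι → ℝ) :
    ∑ i, ∑ j, w i * w j * (t i + t j) = 2 * ∑ i, w i * t i := by
  have h1 : ∑ i, ∑ j, w i * w j * t i = ∑ i, w i * t i := Finset.sum_congr rfl fun i _ => by
    rw [← Finset.sum_mul, ← Finset.mul_sum, hs, mul_one]
  have h2 : ∑ i, ∑ j, w i * w j * t j = ∑ i, w i * t i := by
    rw [Finset.sum_comm]
    exact Finset.sum_congr rfl fun i _ => by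
      rw [← Finset.sum_mul, ← Finset.sum_mul, hs, one_mul]
  simp only [mul_add, Finset.sum_add_distrib, h1, h2]
  ring

/-- If every finite convex decomposition of `ω` induces the product decomposition of `Ω`, then
the entanglement of formation of `Ω` is at most twice that of `ω`. -/
theorem eof_le_two_mul (A : StarSubalgebra ℂ (HTensor H K →L[ℂ] HTensor H K))
    (hA : ∀ a : H →L[ℂ] H, opTensor a (1 : K →L[ℂ] K) ∈ A)
    (B : StarSubalgebra ℂ (HTensor (HTensor H H) L →L[ℂ] HTensor (HTensor H H) L))
    (hB : ∀ a : HTensor H H →L[ℂ] HTensor H H, opTensor a (1 : L →L[ℂ] L) ∈ B)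
    (ω : State A) (Ω : State B)
    (h : ∀ {ι : Type} [Fintype ι] (w : ι → ℝ) (φ : ι → State A), (∀ i, 0 < w i) →
      (∀ a, ∑ i, (w i : ℂ) * (φ i).toCLM a = ω.toCLM a) →
      ∃ Φ : ι → ι → State B,
        (∀ x, ∑ i, ∑ j, (w i : ℂ) * w j * (Φ i j).toCLM x = Ω.toCLM x) ∧
        ∀ i j (a b : H →L[ℂ] H), (Φ i j).toCLM ⟨opTensor (opTensor a b) 1, hB _⟩ =
          (φ i).toCLM ⟨opTensor a 1, hA a⟩ * (φ j).toCLM ⟨opTensor b 1, hA b⟩) :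
    eof B hB Ω ≤ 2 * eof A hA ω := by
  rw [← div_le_iff₀' two_pos]
  -- The Dirac measure at `ω` is a competitor, so `sInf` is not the default value of the empty set.
  refine le_csInf ((measuresWithBarycenter_nonempty ω).image _) ?_
  rintro _ ⟨μ, hμ, rfl⟩
  refine le_of_forall_pos_le_add fun ε hε => ?_
  obtain ⟨ι, _, w, φ, hw, hs, hφ, hle⟩ := exists_finite_decomposition
    (StarAlgHom.codRestrict (leftEmbedding (H := H) (K := K)) A hA) (Continuous.subtype_mk
    (f := leftEmbedding (H := H) (K := K)) (map_continuous _) hA) hμ hε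
  obtain ⟨Φ, hΦ, hprod⟩ := h w φ hw hφ
  have hent : ∀ i j, vonNeumannEntropy (restriction B hB (Φ i j)) =
      vonNeumannEntropy (restriction A hA (φ i)) + vonNeumannEntropy (restriction A hA (φ j)) :=
    fun i j => vonNeumannEntropy_tensor _ _ _ (hprod i j)
  have key := eof_le_sum B hB (w := fun k : ι × ι => w k.1 * w k.2) (Φ := fun k => Φ k.1 k.2)
    (Ω := Ω) (fun k => (mul_pos (hw _) (hw _)).le)
    (by rw [Fintype.sum_prod_type]; simp only [← Finset.mul_sum, hs, mul_one])
    (fun x => by rw [Fintype.sum_prod_type]; push_cast; exact hΦ x)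
  refine le_trans ?_ hle
  rw [div_le_iff₀' two_pos]
  refine key.trans_eq ?_
  rw [Fintype.sum_prod_type, ← sum_mul_mul_add hs]
  exact Finset.sum_congr rfl fun i _ => Finset.sum_congr rfl fun j _ =>
    congrArg (w i * w j * ·) (hent i j)

end Subadditivity

/-! ### Regrouping of vectors in the fourfold tensor product -/

section Shuffle

variable (H K : Type*) [NormedAddCommGroup H] [InnerProductSpace ℂ H]
  [NormedAddCommGroup K] [InnerProductSpace ℂ K]

/-- The algebraic shuffle `(x ⊗ y, x' ⊗ y') ↦ (x ⊗ x') ⊗ (y ⊗ y')`. -/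
def algShuffle : H ⊗[ℂ] K →ₗ[ℂ] H ⊗[ℂ] K →ₗ[ℂ] HTensor (HTensor H H) (HTensor K K) :=
  (TensorProduct.mk ℂ (H ⊗[ℂ] K) (H ⊗[ℂ] K)).compr₂
    ((HTensor.incl (HTensor H H) (HTensor K K)).toLinearMap ∘ₗ
      TensorProduct.map (HTensor.incl H H).toLinearMap (HTensor.incl K K).toLinearMap ∘ₗ
      (TensorProduct.tensorTensorTensorComm ℂ H K H K).toLinearMap)

variable {H K}

theorem algShuffle_tmul (x x' : H) (y y' : K) :
    algShuffle H K (x ⊗ₜ y) (x' ⊗ₜ y') =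
      HTensor.tmul (HTensor.tmul x x') (HTensor.tmul y y') := rfl

theorem inner_algShuffle (u v u' v' : H ⊗[ℂ] K) :
    inner ℂ (algShuffle H K u v) (algShuffle H K u' v') = inner ℂ u u' * inner ℂ v v' := by
  induction u using TensorProduct.induction_on with
  | zero => simp
  | add p q hp hq => simp only [map_add, LinearMap.add_apply, inner_add_left, hp, hq, add_mul]
  | tmul x y =>
    induction v using TensorProduct.induction_on with
    | zero => simp
    | add p q hp hq => simp only [map_add, inner_add_left, hp, hq, mul_add]
    | tmul x₁ y₁ =>
      induction u' using TensorProduct.induction_on with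
      | zero => simp
      | add p q hp hq => simp only [map_add, LinearMap.add_apply, inner_add_right, hp, hq, add_mul]
      | tmul x₂ y₂ =>
        induction v' using TensorProduct.induction_on with
        | zero => simp
        | add p q hp hq => simp only [map_add, inner_add_right, hp, hq, mul_add]
        | tmul x₃ y₃ =>
          simp only [algShuffle_tmul, HTensor.inner_tmul, TensorProduct.inner_tmul]
          ring

theorem norm_algShuffle (u v : H ⊗[ℂ] K) : ‖algShuffle H K u v‖ = ‖u‖ * ‖v‖ := by
  have h := inner_algShuffle u v u v
  rw [inner_self_eq_norm_sq_to_K, inner_self_eq_norm_sq_to_K (𝕜 := ℂ) u,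
    inner_self_eq_norm_sq_to_K (𝕜 := ℂ) v] at h
  have h2 : ‖algShuffle H K u v‖ ^ 2 = (‖u‖ * ‖v‖) ^ 2 := by
    rw [mul_pow]; exact_mod_cast h
  exact (sq_eq_sq₀ (norm_nonneg _) (by positivity)).mp h2

variable (H K)

/-- The shuffle on the algebraic tensor product as a continuous bilinear map. -/
def algShuffleL : H ⊗[ℂ] K →L[ℂ] H ⊗[ℂ] K →L[ℂ] HTensor (HTensor H H) (HTensor K K) :=
  (algShuffle H K).mkContinuous₂ 1 fun u v => by rw [norm_algShuffle, one_mul]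

/-- The continuous bilinear shuffle `(x ⊗ y, x' ⊗ y') ↦ (x ⊗ x') ⊗ (y ⊗ y')`. -/
def shuffle : HTensor H K →L[ℂ] HTensor H K →L[ℂ] HTensor (HTensor H H) (HTensor K K) :=
  -- Extension by density acts on one variable at a time, hence the two flips.
  (((algShuffleL H K).extend (HTensor.incl H K).toContinuousLinearMap).flip.extend
    (HTensor.incl H K).toContinuousLinearMap).flip

variable {H K}

theorem shuffle_incl (u v : H ⊗[ℂ] K) :
    shuffle H K (HTensor.incl H K u) (HTensor.incl H K v) = algShuffle H K u v := by
  have hd : DenseRange (HTensor.incl H K).toContinuousLinearMap := HTensor.denseRange_incl H K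
  have hu : IsUniformInducing (HTensor.incl H K).toContinuousLinearMap :=
    (HTensor.incl H K).isometry.isUniformInducing
  have h1 := ContinuousLinearMap.extend_eq
    ((algShuffleL H K).extend (HTensor.incl H K).toContinuousLinearMap).flip hd hu v
  have h2 := ContinuousLinearMap.extend_eq (algShuffleL H K) hd hu u
  calc _ = (((algShuffleL H K).extend (HTensor.incl H K).toContinuousLinearMap).flip.extend
        (HTensor.incl H K).toContinuousLinearMap)
          ((HTensor.incl H K).toContinuousLinearMap v) (HTensor.incl H K u) := rfl
    _ = ((algShuffleL H K).extend (HTensor.incl H K).toContinuousLinearMap)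
          ((HTensor.incl H K).toContinuousLinearMap u) v := by rw [h1]; rfl
    _ = _ := by rw [h2]; rfl

theorem inner_shuffle (u v u' v' : HTensor H K) :
    inner ℂ (shuffle H K u v) (shuffle H K u' v') = inner ℂ u u' * inner ℂ v v' := by
  induction u, v using (HTensor.denseRange_incl H K).induction_on₂ with
  | hp => exact isClosed_eq (by fun_prop) (by fun_prop)
  | h u v =>
    induction u', v' using (HTensor.denseRange_incl H K).induction_on₂ with
    | hp => exact isClosed_eq (by fun_prop) (by fun_prop)
    | h u' v' =>
      rw [shuffle_incl, shuffle_incl, inner_algShuffle, LinearIsometry.inner_map_map,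
        LinearIsometry.inner_map_map]

theorem norm_shuffle (u v : HTensor H K) : ‖shuffle H K u v‖ = ‖u‖ * ‖v‖ := by
  have h := inner_shuffle u v u v
  simp only [inner_self_eq_norm_sq_to_K] at h
  have h2 : ‖shuffle H K u v‖ ^ 2 = (‖u‖ * ‖v‖) ^ 2 := by
    rw [mul_pow]; exact_mod_cast h
  exact (sq_eq_sq₀ (norm_nonneg _) (by positivity)).mp h2

theorem opTensor_shuffle (a b : H →L[ℂ] H) (m n : K →L[ℂ] K) (u v : HTensor H K) :
    opTensor (opTensor a b) (opTensor m n) (shuffle H K u v) =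
      shuffle H K (opTensor a m u) (opTensor b n v) := by
  induction u, v using (HTensor.denseRange_incl H K).induction_on₂ with
  | hp => exact isClosed_eq (by fun_prop) (by fun_prop)
  | h u v =>
    induction u using TensorProduct.induction_on with
    | zero => simp
    | add p q hp hq => simp only [map_add, add_apply, hp, hq]
    | tmul x y =>
      induction v using TensorProduct.induction_on with
      | zero => simp
      | add p q hp hq => simp only [map_add, hp, hq]
      | tmul x₁ y₁ =>
        rw [shuffle_incl, algShuffle_tmul, opTensor_incl, opTensor_incl, shuffle_incl]
        simp [algShuffle_tmul]

end Shuffle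

/-! ### Slice maps and products of bounded functionals -/

section ProductFunctional

variable {H L : Type*} [NormedAddCommGroup H] [InnerProductSpace ℂ H] [CompleteSpace H]
  [NormedAddCommGroup L] [InnerProductSpace ℂ L] [CompleteSpace L]

/-- The slice `T(·, v)† x T(·, v')` of an operator `x`. -/
def slice (T : H →L[ℂ] H →L[ℂ] L) (x : L →L[ℂ] L) (v v' : H) : H →L[ℂ] H :=
  (ContinuousLinearMap.adjoint (T.flip v)).comp (x.comp (T.flip v'))

theorem norm_slice_le (T : H →L[ℂ] H →L[ℂ] L) (x : L →L[ℂ] L) (v v' : H) :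
    ‖slice T x v v'‖ ≤ ‖T‖ ^ 2 * ‖x‖ * ‖v‖ * ‖v'‖ := by
  have h : ∀ v, ‖T.flip v‖ ≤ ‖T‖ * ‖v‖ := fun v =>
    (T.flip.le_opNorm v).trans_eq (by rw [ContinuousLinearMap.opNorm_flip])
  calc ‖slice T x v v'‖ ≤ ‖ContinuousLinearMap.adjoint (T.flip v)‖ * (‖x‖ * ‖T.flip v'‖) :=
        (ContinuousLinearMap.opNorm_comp_le _ _).trans
          (by gcongr; exact ContinuousLinearMap.opNorm_comp_le _ _)
    _ ≤ (‖T‖ * ‖v‖) * (‖x‖ * (‖T‖ * ‖v'‖)) := by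
        rw [LinearIsometryEquiv.norm_map]; gcongr <;> exact h _
    _ = _ := by ring

theorem slice_add_left (T : H →L[ℂ] H →L[ℂ] L) (x : L →L[ℂ] L) (v w v' : H) :
    slice T x (v + w) v' = slice T x v v' + slice T x w v' := by
  simp [slice, ContinuousLinearMap.add_comp]

theorem slice_add_right (T : H →L[ℂ] H →L[ℂ] L) (x : L →L[ℂ] L) (v v' w' : H) :
    slice T x v (v' + w') = slice T x v v' + slice T x v w' := by
  simp [slice, ContinuousLinearMap.comp_add]

theorem slice_smul_left (T : H →L[ℂ] H →L[ℂ] L) (x : L →L[ℂ] L) (c : ℂ) (v v' : H) :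
    slice T x (c • v) v' = (starRingEnd ℂ c) • slice T x v v' := by
  rw [slice, map_smul, map_smulₛₗ, ContinuousLinearMap.smul_comp]
  rfl

theorem slice_smul_right (T : H →L[ℂ] H →L[ℂ] L) (x : L →L[ℂ] L) (c : ℂ) (v v' : H) :
    slice T x v (c • v') = c • slice T x v v' := by
  simp [slice]

theorem slice_add (T : H →L[ℂ] H →L[ℂ] L) (x y : L →L[ℂ] L) (v v' : H) :
    slice T (x + y) v v' = slice T x v v' + slice T y v v' := by
  simp [slice, ContinuousLinearMap.comp_add, ContinuousLinearMap.add_comp]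

theorem slice_smul (T : H →L[ℂ] H →L[ℂ] L) (c : ℂ) (x : L →L[ℂ] L) (v v' : H) :
    slice T (c • x) v v' = c • slice T x v v' := by
  simp [slice, ContinuousLinearMap.smul_comp]

/-- The slice of an operator by a bounded functional on the left factor. -/
theorem exists_partial_apply (T : H →L[ℂ] H →L[ℂ] L) (f : (H →L[ℂ] H) →L[ℂ] ℂ) (x : L →L[ℂ] L) :
    ∃ R : H →L[ℂ] H, (∀ v v', inner ℂ v (R v') = f (slice T x v v')) ∧
      ‖R‖ ≤ ‖f‖ * ‖T‖ ^ 2 * ‖x‖ := by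
  have hbound : ∀ v v', ‖f (slice T x v v')‖ ≤ ‖f‖ * ‖T‖ ^ 2 * ‖x‖ * ‖v‖ * ‖v'‖ := fun v v' =>
    (f.le_opNorm _).trans <| by
      rw [mul_assoc, mul_assoc, mul_assoc]
      gcongr
      simpa only [mul_assoc] using norm_slice_le T x v v'
  -- A bounded sesquilinear form, which the Riesz theorem represents by an operator.
  let B : H →L⋆[ℂ] H →L[ℂ] ℂ := LinearMap.mkContinuous₂
    (LinearMap.mk₂'ₛₗ (starRingEnd ℂ) (RingHom.id ℂ) (fun v v' => f (slice T x v v'))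
      (fun v w v' => by rw [slice_add_left, map_add])
      (fun c v v' => by rw [slice_smul_left, map_smul])
      (fun v v' w => by rw [slice_add_right, map_add])
      (fun c v v' => by rw [slice_smul_right, map_smul]; rfl)) (‖f‖ * ‖T‖ ^ 2 * ‖x‖) hbound
  have hR : ∀ v v', inner ℂ v (ContinuousLinearMap.adjoint
      (InnerProductSpace.continuousLinearMapOfBilin B) v') = f (slice T x v v') := fun v v' => by
    rw [ContinuousLinearMap.adjoint_inner_right,
      InnerProductSpace.continuousLinearMapOfBilin_apply]
    rfl
  refine ⟨_, hR, ContinuousLinearMap.opNorm_le_bound _ (by positivity) fun v' => ?_⟩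
  set R := ContinuousLinearMap.adjoint (InnerProductSpace.continuousLinearMapOfBilin B)
  rcases (norm_nonneg (R v')).eq_or_lt with h0 | h0
  · rw [← h0]; positivity
  -- Test the form against the vector `R v'` itself.
  · refine le_of_mul_le_mul_right ?_ h0
    calc ‖R v'‖ * ‖R v'‖ = ‖inner ℂ (R v') (R v')‖ := by
          rw [inner_self_eq_norm_sq_to_K, ← sq]; simp
      _ ≤ ‖f‖ * ‖T‖ ^ 2 * ‖x‖ * ‖R v'‖ * ‖v'‖ := by rw [hR]; exact hbound _ _
      _ = _ := by ring

/-- The product of two bounded functionals on `B(H)`, as a bounded functional on `B(L)`, where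
`L` contains the product vectors `T u v`. -/
theorem exists_product_functional (T : H →L[ℂ] H →L[ℂ] L)
    (hT : ∀ u v u' v', inner ℂ (T u v) (T u' v') = inner ℂ u u' * inner ℂ v v')
    (f g : (H →L[ℂ] H) →L[ℂ] ℂ) :
    ∃ F : (L →L[ℂ] L) →L[ℂ] ℂ, ∀ (x : L →L[ℂ] L) (α β : H →L[ℂ] H),
      (∀ u v, x (T u v) = T (α u) (β v)) → F x = f α * g β := by
  choose R hR hRn using exists_partial_apply T f
  let R' : (L →L[ℂ] L) →ₗ[ℂ] (H →L[ℂ] H) :=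
    { toFun := R
      map_add' := fun x y => ContinuousLinearMap.ext fun v' => ext_inner_left ℂ fun v => by
        simp [inner_add_right, hR, slice_add]
      map_smul' := fun c x => ContinuousLinearMap.ext fun v' => ext_inner_left ℂ fun v => by
        simp [inner_smul_right, hR, slice_smul] }
  -- Slice with `f`, then apply `g`. If `x` acts as `α ⊗ β` on product vectors, its slices are `⟨v,
  -- β v'⟩ • α`, so slicing with `f` leaves `f α • β`.
  refine ⟨g.comp (R'.mkContinuous (‖f‖ * ‖T‖ ^ 2) hRn), fun x α β hx => ?_⟩
  have h1 : ∀ v v', slice T x v v' = (inner ℂ v (β v') : ℂ) • α := fun v v' => by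
    refine ContinuousLinearMap.ext fun u' => ext_inner_left ℂ fun u => ?_
    simp only [slice, ContinuousLinearMap.comp_apply, ContinuousLinearMap.adjoint_inner_right,
      ContinuousLinearMap.flip_apply, hx, hT, smul_apply, inner_smul_right]
    ring
  have h2 : R x = f α • β := by
    refine ContinuousLinearMap.ext fun v' => ext_inner_left ℂ fun v => ?_
    rw [hR, h1, map_smul, smul_apply, inner_smul_right, smul_eq_mul]
    ring
  change g (R x) = _
  rw [h2, map_smul, smul_eq_mul]

end ProductFunctional

/-! ### The right tensor factor and spans of elementary tensors -/

section RightTensor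

variable {H K : Type*} [NormedAddCommGroup H] [InnerProductSpace ℂ H]
  [NormedAddCommGroup K] [InnerProductSpace ℂ K]

theorem opTensor_add_right (a : H →L[ℂ] H) (b b' : K →L[ℂ] K) :
    opTensor a (b + b') = opTensor a b + opTensor a b' :=
  op_ext fun x y => by simp [HTensor.tmul, opTensor_incl, TensorProduct.tmul_add]

theorem opTensor_smul_right (c : ℂ) (a : H →L[ℂ] H) (b : K →L[ℂ] K) :
    opTensor a (c • b) = c • opTensor a b :=
  op_ext fun x y => by simp [HTensor.tmul, opTensor_incl]

variable [CompleteSpace H] [CompleteSpace K]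

/-- The *-homomorphism `b ↦ 1 ⊗ b`. -/
def rightEmbedding : (K →L[ℂ] K) →⋆ₐ[ℂ] (HTensor H K →L[ℂ] HTensor H K) where
  toFun b := opTensor 1 b
  map_one' := opTensor_one
  map_mul' b b' := by rw [← opTensor_mul, one_mul]
  map_zero' := by simpa using opTensor_smul_right (0 : ℂ) (1 : H →L[ℂ] H) (0 : K →L[ℂ] K)
  map_add' b b' := opTensor_add_right 1 b b'
  commutes' c := by
    rw [Algebra.algebraMap_eq_smul_one, Algebra.algebraMap_eq_smul_one, opTensor_smul_right,
      opTensor_one]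
  map_star' b := by rw [← opTensor_star, star_one]

omit [CompleteSpace H] [CompleteSpace K] in
theorem opTensor_eq_mul (a : H →L[ℂ] H) (b : K →L[ℂ] K) :
    opTensor a b = opTensor a 1 * opTensor 1 b := by
  rw [← opTensor_mul, mul_one, one_mul]

/-- The continuous linear map `b ↦ a ⊗ b`. -/
def opTensorRight (a : H →L[ℂ] H) : (K →L[ℂ] K) →L[ℂ] (HTensor H K →L[ℂ] HTensor H K) where
  toFun b := opTensor a b
  map_add' := opTensor_add_right a
  map_smul' c b := opTensor_smul_right c a b
  cont := by
    have h : Continuous (rightEmbedding : (K →L[ℂ] K) →⋆ₐ[ℂ] (HTensor H K →L[ℂ] HTensor H K)) :=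
      map_continuous _
    have h2 : (fun b : K →L[ℂ] K => opTensor a b) = fun b => opTensor a 1 *
      (rightEmbedding : (K →L[ℂ] K) →⋆ₐ[ℂ] (HTensor H K →L[ℂ] HTensor H K)) b :=
      funext fun b => opTensor_eq_mul a b
    change Continuous fun b : K →L[ℂ] K => opTensor a b
    rw [h2]
    exact continuous_const.mul h

/-- The vector insertion `y ↦ x ⊗ y`. -/
def HTensor.tmulRight (x : H) : K →L[ℂ] HTensor H K :=
  (HTensor.incl H K).toContinuousLinearMap.comp (TensorProduct.mkL ℂ H K x)

omit [CompleteSpace H] [CompleteSpace K] in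
theorem HTensor.tmulRight_apply (x : H) (y : K) : HTensor.tmulRight x y = HTensor.tmul x y := rfl

omit [CompleteSpace H] [CompleteSpace K] in
theorem HTensor.ext_inner_tmul {z z' : HTensor H K}
    (h : ∀ (x : H) (y : K), inner ℂ (HTensor.tmul x y) z = inner ℂ (HTensor.tmul x y) z') :
    z = z' := by
  refine ext_inner_left ℂ fun u => ?_
  induction u using (HTensor.denseRange_incl H K).induction_on with
  | hp => exact isClosed_eq (by fun_prop) (by fun_prop)
  | ih u =>
    induction u using TensorProduct.induction_on with
    | zero => simp
    | tmul x y => exact h x y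
    | add p q hp hq => rw [map_add, inner_add_left, inner_add_left, hp, hq]

/-- The linear span of a self-adjoint multiplicative monoid is already a *-algebra. -/
theorem adjoin_subset_span {A : Type*} [Ring A] [StarRing A] [Algebra ℂ A] [StarModule ℂ A]
    {S : Set A} (h1 : 1 ∈ S) (hmul : ∀ x ∈ S, ∀ y ∈ S, x * y ∈ S) (hstar : ∀ x ∈ S, star x ∈ S) :
    (StarAlgebra.adjoin ℂ S : Set A) ⊆ Submodule.span ℂ S := by
  have hm : ∀ x y, x ∈ Submodule.span ℂ S → y ∈ Submodule.span ℂ S →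
      x * y ∈ Submodule.span ℂ S := fun x y hx hy => by
    induction hx, hy using Submodule.span_induction₂ with
    | mem_mem x y hx hy => exact Submodule.subset_span (hmul x hx y hy)
    | zero_left y hy => simp
    | zero_right x hx => simp
    | add_left x y z _ _ _ h1 h2 => rw [add_mul]; exact add_mem h1 h2
    | add_right x y z _ _ _ h1 h2 => rw [mul_add]; exact add_mem h1 h2
    | smul_left r x y _ _ h => rw [smul_mul_assoc]; exact Submodule.smul_mem _ _ h
    | smul_right r x y _ _ h => rw [mul_smul_comm]; exact Submodule.smul_mem _ _ h
  have hs : ∀ x, x ∈ Submodule.span ℂ S → star x ∈ Submodule.span ℂ S := fun x hx => by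
    induction hx using Submodule.span_induction with
    | mem x hx => exact Submodule.subset_span (hstar x hx)
    | zero => simp
    | add x y _ _ h1 h2 => rw [star_add]; exact add_mem h1 h2
    | smul r x _ h => rw [star_smul]; exact Submodule.smul_mem _ _ h
  intro x hx
  refine StarAlgebra.adjoin_induction (p := fun x _ => x ∈ Submodule.span ℂ S)
    (fun x h => Submodule.subset_span h) (fun r => ?_) (fun x y _ _ => Submodule.add_mem _)
    (fun x y _ _ => hm x y) (fun x _ => hs x) hx
  rw [Algebra.algebraMap_eq_smul_one]
  exact Submodule.smul_mem _ _ (Submodule.subset_span h1)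

theorem adjoin_elementaryTensors_subset_span (M : StarSubalgebra ℂ (H →L[ℂ] H))
    (N : StarSubalgebra ℂ (K →L[ℂ] K)) :
    (StarAlgebra.adjoin ℂ (elementaryTensors M N) : Set (HTensor H K →L[ℂ] HTensor H K)) ⊆
      Submodule.span ℂ (elementaryTensors M N) := by
  refine adjoin_subset_span ⟨1, one_mem _, 1, one_mem _, opTensor_one.symm⟩ ?_ ?_
  · rintro _ ⟨a, ha, b, hb, rfl⟩ _ ⟨a', ha', b', hb', rfl⟩
    exact ⟨_, mul_mem ha ha', _, mul_mem hb hb', (opTensor_mul _ _ _ _).symm⟩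
  · rintro _ ⟨a, ha, b, hb, rfl⟩
    exact ⟨_, star_mem ha, _, star_mem hb, (opTensor_star _ _).symm⟩

theorem spatialTensor_subset_closure_span (M : StarSubalgebra ℂ (H →L[ℂ] H))
    (N : StarSubalgebra ℂ (K →L[ℂ] K)) :
    (spatialTensor M N : Set (HTensor H K →L[ℂ] HTensor H K)) ⊆
      closure (Submodule.span ℂ (elementaryTensors M N) : Set _) := by
  rw [spatialTensor, StarSubalgebra.topologicalClosure_coe]
  exact closure_mono (adjoin_elementaryTensors_subset_span M N)

end RightTensor

/-! ### Generation of the fourfold algebras by product tensors -/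

section Fourfold

variable {H K : Type*} [NormedAddCommGroup H] [InnerProductSpace ℂ H] [CompleteSpace H]
  [NormedAddCommGroup K] [InnerProductSpace ℂ K] [CompleteSpace K]

/-- The operators `(a ⊗ b) ⊗ (m ⊗ n)` with `m, n ∈ M`. -/
def productTensors (H : Type*) [NormedAddCommGroup H] [InnerProductSpace ℂ H]
    (M : StarSubalgebra ℂ (K →L[ℂ] K)) :
    Set (HTensor (HTensor H H) (HTensor K K) →L[ℂ] HTensor (HTensor H H) (HTensor K K)) :=
  {x | ∃ a b : H →L[ℂ] H, ∃ m ∈ M, ∃ n ∈ M, x = opTensor (opTensor a b) (opTensor m n)}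

-- This is where finite dimension reduces `B(H ⊗ H)` to `B(H) ⊗ B(H)`: membership is linear in `c`,
-- and the operators `a ⊗ b` span.
omit [CompleteSpace H] in
theorem opTensor_mem_of_forall_tensor [FiniteDimensional ℂ H] {L : Type*} [NormedAddCommGroup L] [InnerProductSpace ℂ L]
    {V : Submodule ℂ (HTensor (HTensor H H) L →L[ℂ] HTensor (HTensor H H) L)} {d : L →L[ℂ] L}
    (h : ∀ a b : H →L[ℂ] H, opTensor (opTensor a b) d ∈ V) (c : HTensor H H →L[ℂ] HTensor H H) :
    opTensor c d ∈ V := by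
  have hc : c ∈ Submodule.span ℂ
      (Set.range fun p : (H →L[ℂ] H) × (H →L[ℂ] H) => opTensor p.1 p.2) := by
    rw [span_opTensor_eq_top]; trivial
  induction hc using Submodule.span_induction with
  | mem c hc => obtain ⟨p, rfl⟩ := hc; exact h p.1 p.2
  | zero =>
    have := opTensor_smul_left (0 : ℂ) (0 : HTensor H H →L[ℂ] HTensor H H) d
    rw [zero_smul, zero_smul] at this
    rw [this]; exact V.zero_mem
  | add c c' _ _ h1 h2 => rw [opTensor_add_left]; exact V.add_mem h1 h2
  | smul r c _ h1 => rw [opTensor_smul_left]; exact V.smul_mem _ h1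

theorem adjoin_productTensors_subset_span (M : StarSubalgebra ℂ (K →L[ℂ] K)) :
    (StarAlgebra.adjoin ℂ (productTensors H M) : Set (HTensor (HTensor H H) (HTensor K K) →L[ℂ]
      HTensor (HTensor H H) (HTensor K K))) ⊆ Submodule.span ℂ (productTensors H M) := by
  refine adjoin_subset_span ⟨1, 1, 1, one_mem _, 1, one_mem _, by simp only [opTensor_one]⟩ ?_ ?_
  · rintro _ ⟨a, b, m, hm, n, hn, rfl⟩ _ ⟨a', b', m', hm', n', hn', rfl⟩
    exact ⟨a * a', b * b', _, mul_mem hm hm', _, mul_mem hn hn', by simp only [opTensor_mul]⟩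
  · rintro _ ⟨a, b, m, hm, n, hn, rfl⟩
    exact ⟨star a, star b, _, star_mem hm, _, star_mem hn, by simp only [opTensor_star]⟩

/-- The approximation has two layers, the outer tensor product and then `d ∈ M ⊗ M`; the inner one
is carried over by continuity of `d ↦ (a ⊗ b) ⊗ d`. -/
theorem fourfold_subset_closure_span [FiniteDimensional ℂ H] (M : StarSubalgebra ℂ (K →L[ℂ] K)) :
    (fourfold H M : Set (HTensor (HTensor H H) (HTensor K K) →L[ℂ]
      HTensor (HTensor H H) (HTensor K K))) ⊆
      closure (Submodule.span ℂ (productTensors H M) : Set _) := by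
  refine (spatialTensor_subset_closure_span _ _).trans (closure_minimal ?_ isClosed_closure)
  rw [← Submodule.topologicalClosure_coe]
  refine Submodule.span_le.2 ?_
  rintro _ ⟨c, -, d, hd, rfl⟩
  refine opTensor_mem_of_forall_tensor (fun a b => ?_) c
  have h1 : Set.MapsTo (opTensorRight (opTensor a b))
      (Submodule.span ℂ (elementaryTensors M M) : Set (HTensor K K →L[ℂ] HTensor K K))
      (Submodule.span ℂ (productTensors H M)) := by
    have : Submodule.span ℂ (elementaryTensors M M) ≤
        (Submodule.span ℂ (productTensors H M)).comap (opTensorRight (opTensor a b)).toLinearMap := by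
      refine Submodule.span_le.2 ?_
      rintro _ ⟨m, hm, n, hn, rfl⟩
      exact Submodule.subset_span ⟨a, b, m, hm, n, hn, rfl⟩
    exact this
  exact map_mem_closure (opTensorRight (opTensor a b)).continuous
    (spatialTensor_subset_closure_span M M hd) h1

/-- Centralizers reverse inclusions, so it is enough that an operator `g` commuting with all product
tensors commutes with every `c ⊗ d`. The factors `1 ⊗ d` and `c ⊗ 1` are treated separately. -/
theorem fourfoldVN_le_bicommutant [FiniteDimensional ℂ H] (M : VonNeumannAlgebra K) :
    fourfoldVN H M ≤ StarSubalgebra.centralizer ℂ (StarSubalgebra.centralizer ℂ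
      (productTensors H M.toStarSubalgebra) : Set _) := by
  refine StarSubalgebra.centralizer_le ℂ _ _ fun g hg => ?_
  -- operators commuting with the product tensors commute with `1 ⊗ d`
  have key : ∀ g ∈ StarSubalgebra.centralizer ℂ (productTensors H M.toStarSubalgebra),
      ∀ d ∈ vnTensor M.toStarSubalgebra M.toStarSubalgebra, ∀ c : HTensor H H →L[ℂ] HTensor H H,
      opTensor c d * g = g * opTensor c d := by
    intro g hg d hd c
    have hgr : ∀ a b : H →L[ℂ] H, ∀ e ∈ elementaryTensors M.toStarSubalgebra M.toStarSubalgebra,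
        opTensor (opTensor a b) e * g = g * opTensor (opTensor a b) e := by
      rintro a b _ ⟨m, hm, n, hn, rfl⟩
      exact (((StarSubalgebra.mem_centralizer_iff ℂ).1 hg) _ ⟨a, b, m, hm, n, hn, rfl⟩).1
    -- The slices (matrix entries over the left factor) of `g` commute with all `m ⊗ n`, hence with
    -- `d`, which lies in the bicommutant. Since the slices determine `g`, it commutes with `1 ⊗ d`.
    let s : HTensor H H → HTensor H H → HTensor K K →L[ℂ] HTensor K K := fun u u' =>
      (ContinuousLinearMap.adjoint (HTensor.tmulRight u)).comp (g.comp (HTensor.tmulRight u'))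
    have hs : ∀ u u' w w', inner ℂ w (s u u' w') =
        inner ℂ (HTensor.tmul u w) (g (HTensor.tmul u' w')) := fun u u' w w' => by
      simp only [s, ContinuousLinearMap.comp_apply, ContinuousLinearMap.adjoint_inner_right,
        HTensor.tmulRight_apply]
    have hright : ∀ (e : HTensor K K →L[ℂ] HTensor K K) (u : HTensor H H) (w : HTensor K K) z,
        inner ℂ (HTensor.tmul u w) (opTensor (1 : HTensor H H →L[ℂ] HTensor H H) e z) =
          inner ℂ (HTensor.tmul u (ContinuousLinearMap.adjoint e w)) z := fun e u w z => by
      have h2 : opTensor (1 : HTensor H H →L[ℂ] HTensor H H) e =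
          ContinuousLinearMap.adjoint (opTensor 1 (star e)) := by
        rw [← ContinuousLinearMap.star_eq_adjoint, ← opTensor_star, star_star, star_one]
      rw [h2, ContinuousLinearMap.adjoint_inner_right, opTensor_tmul]
      rfl
    have hsmem : ∀ u u', s u u' ∈ StarSubalgebra.centralizer ℂ
        (elementaryTensors M.toStarSubalgebra M.toStarSubalgebra) := by
      intro u u'
      have hcomm : ∀ e ∈ elementaryTensors M.toStarSubalgebra M.toStarSubalgebra,
          e * s u u' = s u u' * e := by
        intro e he
        refine ContinuousLinearMap.ext fun w' => ext_inner_left ℂ fun w => ?_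
        have h1 := congrArg (fun T => inner ℂ (HTensor.tmul u w) (T (HTensor.tmul u' w')))
          (hgr 1 1 e he)
        simp only [opTensor_one, mul_apply_eq_comp, hright, opTensor_tmul] at h1
        rw [mul_apply_eq_comp, mul_apply_eq_comp, hs,
          ← ContinuousLinearMap.adjoint_inner_left, hs, h1]
        rfl
      refine (StarSubalgebra.mem_centralizer_iff ℂ).2 fun e he => ⟨hcomm e he, hcomm _ ?_⟩
      obtain ⟨m, hm, n, hn, rfl⟩ := he
      exact ⟨_, star_mem hm, _, star_mem hn, (opTensor_star m n).symm⟩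
    have hd1 : opTensor (1 : HTensor H H →L[ℂ] HTensor H H) d * g = g * opTensor 1 d := by
      refine op_ext fun u' w' => HTensor.ext_inner_tmul fun u w => ?_
      have h1 := ((StarSubalgebra.mem_centralizer_iff ℂ).1 hd _ (hsmem u u')).1
      have h2 := congrArg (fun T => inner ℂ w (T w')) h1
      simp only [mul_apply_eq_comp, hs] at h2
      rw [← ContinuousLinearMap.adjoint_inner_left d, hs] at h2
      simp only [mul_apply_eq_comp, hright, opTensor_tmul]
      exact h2.symm
    have hc1 : opTensor c (1 : HTensor K K →L[ℂ] HTensor K K) * g = g * opTensor c 1 := by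
      let V : Submodule ℂ (HTensor (HTensor H H) (HTensor K K) →L[ℂ]
          HTensor (HTensor H H) (HTensor K K)) :=
        LinearMap.ker (LinearMap.mulRight ℂ g - LinearMap.mulLeft ℂ g)
      have hV : ∀ x, x ∈ V ↔ x * g = g * x := fun x => by
        simp [V, sub_eq_zero]
      rw [← hV]
      refine opTensor_mem_of_forall_tensor (fun a b => (hV _).2 (hgr a b 1 ?_)) c
      exact ⟨1, one_mem _, 1, one_mem _, opTensor_one.symm⟩
    rw [opTensor_eq_mul, mul_assoc, hd1, ← mul_assoc, hc1, mul_assoc]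
  rw [SetLike.mem_coe, StarSubalgebra.mem_centralizer_iff]
  rintro _ ⟨c, -, d, hd, rfl⟩
  refine ⟨key g hg d hd c, ?_⟩
  rw [← opTensor_star]
  exact key g hg _ (star_mem hd) _

end Fourfold

/-! ### Positivity of products by the Schur product theorem -/

section Positivity

theorem map_star_sum_mul_sum {A : Type*} [Ring A] [Algebra ℂ A] [StarRing A] [StarModule ℂ A]
    [TopologicalSpace A] (f : A →L[ℂ] ℂ) {r : ℕ} (c : Fin r → ℂ) (x : Fin r → A) :
    f (star (∑ i, c i • x i) * ∑ i, c i • x i) =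
      ∑ i, ∑ j, star (c i) * (f (star (x i) * x j) * c j) := by
  rw [star_sum, Finset.sum_mul_sum, map_sum]
  refine Finset.sum_congr rfl fun i _ => ?_
  rw [map_sum]
  refine Finset.sum_congr rfl fun j _ => ?_
  rw [star_smul, smul_mul_smul_comm, map_smul, smul_eq_mul]
  ring

theorem State.posSemidef_gram {A : Type*} [NormedRing A] [NormedAlgebra ℂ A] [StarRing A]
    [StarModule ℂ A] (φ : State A) {r : ℕ} (α : Fin r → A) :
    (Matrix.of fun i j => φ.toCLM (star (α i) * α j)).PosSemidef := by
  refine Matrix.PosSemidef.of_dotProduct_mulVec_nonneg ?_ fun x => ?_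
  · ext i j
    rw [Matrix.conjTranspose_apply, Matrix.of_apply, Matrix.of_apply, ← State.toCLM_star, star_mul,
      star_star]
  · have h := φ.toCLM_star_mul_self_nonneg (∑ i, x i • α i)
    rw [map_star_sum_mul_sum] at h
    simpa only [dotProduct, Matrix.mulVec, Matrix.of_apply, Pi.star_apply, Finset.mul_sum] using h

/-- Hahn–Banach. Positivity of the extension is not claimed; `product_nonneg` uses only the values
on the algebra. -/
theorem State.exists_extension {E : Type*} [NormedAddCommGroup E] [InnerProductSpace ℂ E]
    [CompleteSpace E] {A : StarSubalgebra ℂ (E →L[ℂ] E)} (φ : State A) :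
    ∃ f : (E →L[ℂ] E) →L[ℂ] ℂ, ∀ a : A, f a = φ.toCLM a := by
  let f₀ : StrongDual ℂ (Subalgebra.toSubmodule A.toSubalgebra) :=
    { toFun := fun x => φ.toCLM ⟨x, x.2⟩
      map_add' := fun x y => map_add φ.toCLM ⟨x, x.2⟩ ⟨y, y.2⟩
      map_smul' := fun c x => map_smul φ.toCLM c ⟨x, x.2⟩
      cont := φ.toCLM.continuous.comp (Continuous.subtype_mk continuous_subtype_val _) }
  obtain ⟨f, hf, -⟩ := exists_extension_norm_eq _ f₀
  exact ⟨f, fun a => hf ⟨a, a.2⟩⟩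

/-- The inclusion of an operator algebra as a continuous linear map. -/
def inclusionL {E : Type*} [NormedAddCommGroup E] [InnerProductSpace ℂ E]
    [CompleteSpace E] (A : StarSubalgebra ℂ (E →L[ℂ] E)) : A →L[ℂ] (E →L[ℂ] E) :=
  ⟨A.subtype.toAlgHom.toLinearMap, continuous_subtype_val⟩

variable {H K : Type*} [NormedAddCommGroup H] [InnerProductSpace ℂ H] [CompleteSpace H]
  [NormedAddCommGroup K] [InnerProductSpace ℂ K] [CompleteSpace K]

/-- A functional which is a product of two states on elementary tensors is positive on their
linear span. -/
theorem product_nonneg {A : StarSubalgebra ℂ (HTensor H K →L[ℂ] HTensor H K)}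
    {M : StarSubalgebra ℂ (K →L[ℂ] K)} (hA : ∀ a : H →L[ℂ] H, ∀ m ∈ M, opTensor a m ∈ A)
    (φ ψ : State A)
    (F : (HTensor (HTensor H H) (HTensor K K) →L[ℂ] HTensor (HTensor H H) (HTensor K K)) →L[ℂ] ℂ)
    (hF : ∀ (a b : H →L[ℂ] H) (m n : K →L[ℂ] K) (hm : m ∈ M) (hn : n ∈ M),
      F (opTensor (opTensor a b) (opTensor m n)) =
        φ.toCLM ⟨opTensor a m, hA a m hm⟩ * ψ.toCLM ⟨opTensor b n, hA b n hn⟩)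
    {y : HTensor (HTensor H H) (HTensor K K) →L[ℂ] HTensor (HTensor H H) (HTensor K K)}
    (hy : y ∈ Submodule.span ℂ (productTensors H M)) : 0 ≤ F (star y * y) := by
  obtain ⟨r, c, g, rfl⟩ := Submodule.mem_span_set'.1 hy
  choose a b m hm n hn h using fun i => (g i).2
  -- Writing `y = ∑ i, c i • g i`, the matrix `F (star (g i) * g j)` is the entrywise product of the
  -- Gram matrices of `φ` and `ψ`, and `F (star y * y)` is its quadratic form at `c`.
  have hpos := ((φ.posSemidef_gram fun i => ⟨opTensor (a i) (m i), hA _ _ (hm i)⟩).hadamard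
    (ψ.posSemidef_gram fun i => ⟨opTensor (b i) (n i), hA _ _ (hn i)⟩)).dotProduct_mulVec_nonneg c
  rw [map_star_sum_mul_sum]
  simp only [dotProduct, Matrix.mulVec, Matrix.of_apply, Pi.star_apply, Finset.mul_sum,
    Matrix.hadamard_apply] at hpos
  refine hpos.trans_eq (Finset.sum_congr rfl fun i _ => Finset.sum_congr rfl fun j _ => ?_)
  rw [h i, h j, ← opTensor_star, ← opTensor_star, ← opTensor_star, ← opTensor_mul, ← opTensor_mul,
    ← opTensor_mul, hF _ _ _ _ (mul_mem (star_mem (hm i)) (hm j))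
      (mul_mem (star_mem (hn i)) (hn j))]
  have e1 : (⟨opTensor (star (a i) * a j) (star (m i) * m j), hA _ _ (mul_mem (star_mem (hm i)) (hm j))⟩ : A)
      = star ⟨opTensor (a i) (m i), hA _ _ (hm i)⟩ * ⟨opTensor (a j) (m j), hA _ _ (hm j)⟩ :=
    Subtype.ext ((opTensor_mul _ _ _ _).trans (by rw [opTensor_star]; rfl))
  have e2 : (⟨opTensor (star (b i) * b j) (star (n i) * n j), hA _ _ (mul_mem (star_mem (hn i)) (hn j))⟩ : A)
      = star ⟨opTensor (b i) (n i), hA _ _ (hn i)⟩ * ⟨opTensor (b j) (n j), hA _ _ (hn j)⟩ :=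
    Subtype.ext ((opTensor_mul _ _ _ _).trans (by rw [opTensor_star]; rfl))
  rw [e1, e2]

end Positivity

/-! ### The C*-algebraic case -/

section Spatial

variable {H K : Type*} [NormedAddCommGroup H] [InnerProductSpace ℂ H] [CompleteSpace H]
  [FiniteDimensional ℂ H] [NormedAddCommGroup K] [InnerProductSpace ℂ K] [CompleteSpace K]
  {M : StarSubalgebra ℂ (K →L[ℂ] K)}

omit [FiniteDimensional ℂ H] in
theorem opTensor_mem_bipartite (a : H →L[ℂ] H) {m : K →L[ℂ] K} (hm : m ∈ M) :
    opTensor a m ∈ bipartite H M :=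
  opTensor_mem_spatial (by trivial) hm

omit [FiniteDimensional ℂ H] in
theorem opTensor_mem_fourfold (a b : H →L[ℂ] H) {m n : K →L[ℂ] K} (hm : m ∈ M) (hn : n ∈ M) :
    opTensor (opTensor a b) (opTensor m n) ∈ fourfold H M :=
  opTensor_mem_spatial (by trivial) (opTensor_mem_spatial hm hn)

/-- The product functional of two extensions is restricted to the algebra; positivity is a
norm-closed condition, known on the dense span of product tensors. -/
theorem exists_product_state (φ ψ : State (bipartite H M)) :
    ∃ Φ : State (fourfold H M), ∀ (a b : H →L[ℂ] H) (m n : K →L[ℂ] K) (hm : m ∈ M) (hn : n ∈ M),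
      Φ.toCLM ⟨opTensor (opTensor a b) (opTensor m n), opTensor_mem_fourfold a b hm hn⟩ =
        φ.toCLM ⟨opTensor a m, opTensor_mem_bipartite a hm⟩ *
          ψ.toCLM ⟨opTensor b n, opTensor_mem_bipartite b hn⟩ := by
  obtain ⟨f, hf⟩ := φ.exists_extension
  obtain ⟨g, hg⟩ := ψ.exists_extension
  obtain ⟨F, hF⟩ := exists_product_functional (shuffle H K) inner_shuffle f g
  have hprod : ∀ (a b : H →L[ℂ] H) (m n : K →L[ℂ] K) (hm : m ∈ M) (hn : n ∈ M),
      F (opTensor (opTensor a b) (opTensor m n)) =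
        φ.toCLM ⟨opTensor a m, opTensor_mem_bipartite a hm⟩ *
          ψ.toCLM ⟨opTensor b n, opTensor_mem_bipartite b hn⟩ := fun a b m n hm hn => by
    rw [hF _ _ _ (opTensor_shuffle a b m n), ← hf, ← hg]
  refine ⟨State.ofCLM (F.comp (inclusionL (fourfold H M))) ?_ fun x => ?_, hprod⟩
  · have h1 := hprod 1 1 1 1 (one_mem _) (one_mem _)
    simp only [opTensor_one] at h1
    exact h1.trans (by rw [show (⟨1, _⟩ : bipartite H M) = 1 from rfl, φ.toCLM_one, ψ.toCLM_one, one_mul])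
  · have hclosed : IsClosed {y | 0 ≤ F (star y * y)} :=
      isClosed_le continuous_const (by fun_prop)
    have hx := closure_minimal (fun y hy => product_nonneg
      (fun a m hm => opTensor_mem_bipartite a hm) φ ψ F hprod hy) hclosed
      (fourfold_subset_closure_span M x.2)
    exact hx

theorem eq_of_eq_on_productTensors
    {f g : (HTensor (HTensor H H) (HTensor K K) →L[ℂ] HTensor (HTensor H H) (HTensor K K)) →L[ℂ] ℂ}
    (h : ∀ (a b : H →L[ℂ] H) (m n : K →L[ℂ] K), m ∈ M → n ∈ M →
      f (opTensor (opTensor a b) (opTensor m n)) = g (opTensor (opTensor a b) (opTensor m n)))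
    {x : HTensor (HTensor H H) (HTensor K K) →L[ℂ] HTensor (HTensor H H) (HTensor K K)}
    (hx : x ∈ fourfold H M) : f x = g x := by
  have hle : Submodule.span ℂ (productTensors H M) ≤ LinearMap.ker (f - g).toLinearMap := by
    refine Submodule.span_le.2 ?_
    rintro _ ⟨a, b, m, hm, n, hn, rfl⟩
    exact sub_eq_zero.2 (h a b m n hm hn)
  exact sub_eq_zero.1
    (closure_minimal hle (f - g).isClosed_ker (fourfold_subset_closure_span M hx))

theorem fourfold_state_ext {Φ Ψ : State (fourfold H M)}
    (h : ∀ (a b : H →L[ℂ] H) (m n : K →L[ℂ] K) (hm : m ∈ M) (hn : n ∈ M),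
      Φ.toCLM ⟨opTensor (opTensor a b) (opTensor m n), opTensor_mem_fourfold a b hm hn⟩ =
        Ψ.toCLM ⟨opTensor (opTensor a b) (opTensor m n), opTensor_mem_fourfold a b hm hn⟩) :
    Φ = Ψ := by
  obtain ⟨f, hf⟩ := Φ.exists_extension
  obtain ⟨g, hg⟩ := Ψ.exists_extension
  refine State.ext fun x => ?_
  rw [← hf, ← hg]
  refine eq_of_eq_on_productTensors (fun a b m n hm hn => ?_) x.2
  have := h a b m n hm hn
  rwa [← hf, ← hg] at this

theorem existsUnique_tensorSquare (ω : State (bipartite H M)) :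
    ∃! Ω : State (fourfold H M), IsTensorSquare ω Ω := by
  obtain ⟨Φ, hΦ⟩ := exists_product_state ω ω
  exact ⟨Φ, hΦ, fun Ψ hΨ => fourfold_state_ext fun a b m n hm hn =>
    (hΨ a b m n hm hn).trans (hΦ a b m n hm hn).symm⟩

theorem eofFourfold_le (ω : State (bipartite H M)) (Ω : State (fourfold H M))
    (hΩ : IsTensorSquare ω Ω) : eofFourfold Ω ≤ 2 * eofBipartite ω := by
  refine eof_le_two_mul _ _ _ _ ω Ω fun {ι} _ w φ _ hφ => ?_
  choose Φ hΦ using fun i j => exists_product_state (φ i) (φ j)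
  refine ⟨Φ, fun x => ?_, fun i j a b => ?_⟩
  · choose f hf using fun i j => (Φ i j).exists_extension
    obtain ⟨g, hg⟩ := Ω.exists_extension
    -- On product tensors the double sum factors into two copies of the decomposition of `ω`.
    have hx := eq_of_eq_on_productTensors (f := ∑ i, ∑ j, ((w i : ℂ) * w j) • f i j) (g := g) ?_ x.2
    · rw [← hg, ← hx]
      simp [hf]
    · intro a b m n hm hn
      have h1 := hg ⟨_, opTensor_mem_fourfold a b hm hn⟩
      have h2 := fun i j => (hf i j ⟨_, opTensor_mem_fourfold a b hm hn⟩).trans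
        (hΦ i j a b m n hm hn)
      have h3 : Ω.toCLM ⟨_, opTensor_mem_fourfold a b hm hn⟩ = _ := hΩ a b m n hm hn
      simp only at h1 h2
      rw [h1, h3, ← State.toCLM_apply, ← State.toCLM_apply, ← hφ, ← hφ, Finset.sum_mul_sum]
      simp only [sum_apply, smul_apply, h2, smul_eq_mul]
      exact Finset.sum_congr rfl fun i _ => Finset.sum_congr rfl fun j _ => by ring
  · have h := hΦ i j a b 1 1 (one_mem _) (one_mem _)
    simp only [opTensor_one] at h
    exact h

end Spatial

/-! ### Infinite amplification and the density theorem -/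

section Amplification

variable {ι κ E : Type*} [NormedAddCommGroup E] [InnerProductSpace ℂ E]

/-- The Hilbert space of square-summable families in `E`. -/
abbrev Amp (ι E : Type*) [NormedAddCommGroup E] [InnerProductSpace ℂ E] : Type _ :=
  lp (fun _ : ι => E) 2

omit [InnerProductSpace ℂ E] in
theorem memℓp_two_iff {ζ : ι → E} : Memℓp ζ 2 ↔ Summable fun i => ‖ζ i‖ ^ 2 := by
  rw [memℓp_gen_iff (by norm_num)]
  norm_num

theorem Amp.hasSum_norm_sq (ζ : Amp ι E) : HasSum (fun i => ‖ζ i‖ ^ 2) (‖ζ‖ ^ 2) := by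
  have h := lp.hasSum_norm (p := 2) (by norm_num) ζ
  norm_num at h
  exact h

/-- The diagonal action of an operator on square-summable families. -/
def diag (x : E →L[ℂ] E) : Amp ι E →L[ℂ] Amp ι E :=
  LinearMap.mkContinuous
    { toFun := fun ζ => ⟨fun i => x (ζ i), memℓp_two_iff.2 <|
        Summable.of_nonneg_of_le (fun i => by positivity)
          (fun i => (pow_le_pow_left₀ (norm_nonneg _) (x.le_opNorm (ζ i)) 2).trans_eq
            (mul_pow _ _ _)) (ζ.hasSum_norm_sq.summable.mul_left (‖x‖ ^ 2))⟩
      map_add' := fun ζ ζ' => by ext i; exact map_add x _ _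
      map_smul' := fun c ζ => by ext i; simp } ‖x‖ fun ζ => by
    refine (sq_le_sq₀ (norm_nonneg _) (by positivity)).1 ?_
    rw [mul_pow]
    refine hasSum_le (fun i => ?_) (Amp.hasSum_norm_sq _)
      ((Amp.hasSum_norm_sq ζ).mul_left (‖x‖ ^ 2))
    exact (pow_le_pow_left₀ (norm_nonneg _) (x.le_opNorm (ζ i)) 2).trans_eq (mul_pow _ _ _)

@[simp] theorem diag_apply (x : E →L[ℂ] E) (ζ : Amp ι E) (i : ι) : diag x ζ i = x (ζ i) := rfl

theorem norm_diag_apply_le (x : E →L[ℂ] E) (ζ : Amp ι E) : ‖diag x ζ‖ ≤ ‖x‖ * ‖ζ‖ :=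
  LinearMap.mkContinuous_norm_le _ (norm_nonneg _) _ |> (diag x).le_of_opNorm_le <| ζ

theorem diag_mul (x y : E →L[ℂ] E) (ζ : Amp ι E) : diag (x * y) ζ = diag x (diag y ζ) := rfl

/-- Evaluation of the diagonal action at a fixed family, as a linear map in the operator. -/
def diagAt (ζ : Amp ι E) : (E →L[ℂ] E) →L[ℂ] Amp ι E :=
  LinearMap.mkContinuous
    { toFun := fun x => diag x ζ
      map_add' := fun x y => by ext i; simp
      map_smul' := fun c x => by ext i; simp } ‖ζ‖ fun x => by
    rw [mul_comm]; exact norm_diag_apply_le x ζ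

/-- Reindexing of square-summable families along an injection. -/
def reindex (f : κ → ι) (hf : Function.Injective f) : Amp ι E →L[ℂ] Amp κ E :=
  LinearMap.mkContinuous
    { toFun := fun ζ => ⟨fun k => ζ (f k), memℓp_two_iff.2 <|
        ζ.hasSum_norm_sq.summable.comp_injective hf⟩
      map_add' := fun ζ ζ' => by ext i; rfl
      map_smul' := fun c ζ => by ext i; rfl } 1 fun ζ => by
    refine (sq_le_sq₀ (norm_nonneg _) (by positivity)).1 ?_
    rw [one_mul, ← (Amp.hasSum_norm_sq _).tsum_eq, ← (Amp.hasSum_norm_sq ζ).tsum_eq]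
    exact tsum_comp_le_tsum_of_inj ζ.hasSum_norm_sq.summable (fun _ => by positivity) hf

/-- Concatenation of square-summable families. -/
def Amp.concat (ξ : Amp ι E) (η : Amp κ E) : Amp (ι ⊕ κ) E :=
  ⟨Sum.elim ξ η, memℓp_two_iff.2 <| Summable.sum _
    ξ.hasSum_norm_sq.summable η.hasSum_norm_sq.summable⟩

variable [CompleteSpace E]

theorem inner_diag_right (x : E →L[ℂ] E) (ζ ξ : Amp ι E) :
    inner ℂ ζ (diag x ξ) = inner ℂ (diag (star x) ζ) ξ := by
  rw [lp.inner_eq_tsum, lp.inner_eq_tsum]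
  refine tsum_congr fun i => ?_
  rw [diag_apply, diag_apply, ContinuousLinearMap.star_eq_adjoint,
    ContinuousLinearMap.adjoint_inner_left]

/-- The density theorem behind the bicommutant theorem: the amplification of an operator in the
bicommutant of a *-algebra is approximated at any vector by the amplification of the algebra. -/
theorem diag_mem_closure (N : StarSubalgebra ℂ (E →L[ℂ] E)) {x : E →L[ℂ] E}
    (hx : x ∈ StarSubalgebra.centralizer ℂ
      (StarSubalgebra.centralizer ℂ (N : Set (E →L[ℂ] E)) : Set (E →L[ℂ] E))) (ζ : Amp ι E) :
    diag x ζ ∈ closure ((fun y => diag y ζ) '' (N : Set (E →L[ℂ] E))) := by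
  classical
  let V₀ : Submodule ℂ (Amp ι E) :=
    (Subalgebra.toSubmodule N.toSubalgebra).map (diagAt ζ).toLinearMap
  let V := V₀.topologicalClosure
  have hV₀ : (V₀ : Set (Amp ι E)) = (fun y => diag y ζ) '' (N : Set (E →L[ℂ] E)) := rfl
  have : CompleteSpace V := V₀.isClosed_topologicalClosure.completeSpace_coe
  have hinv : ∀ s ∈ N, ∀ v ∈ V, diag s v ∈ V := fun s hs v hv => by
    refine map_mem_closure (diag s).continuous hv fun w hw => ?_
    obtain ⟨y, hy, rfl⟩ := hw
    exact ⟨s * y, N.mul_mem hs hy, rfl⟩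
  -- `V` is the closed cyclic subspace of `ζ` under the amplified algebra. It is invariant under a
  -- self-adjoint family, so its projection commutes with that family.
  let P := V.starProjection
  have hcomm : ∀ s ∈ N, ∀ v, P (diag s v) = diag s (P v) := fun s hs v => by
    refine Submodule.eq_starProjection_of_mem_of_inner_eq_zero
      (hinv s hs _ (V.starProjection_apply_mem v)) fun w hw => ?_
    rw [← map_sub, ← inner_conj_symm, inner_diag_right,
      Submodule.inner_right_of_mem_orthogonal (hinv _ (star_mem hs) w hw)
        (V.sub_starProjection_mem_orthogonal v), map_zero]
  -- The matrix entries of `P` lie in the commutant of `N`, so `x` commutes with each of them and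
  -- `diag x` commutes with `P`.
  let p : ι → ι → E →L[ℂ] E := fun i j =>
    (lp.evalCLM ℂ (fun _ : ι => E) 2 i).comp
      (P.comp (lp.singleContinuousLinearMap ℂ (fun _ : ι => E) 2 j))
  have hp : ∀ i j v, p i j v = P (lp.single 2 j v) i := fun i j v => rfl
  have hsingle : ∀ (y : E →L[ℂ] E) j v,
      diag y (lp.single 2 j v : Amp ι E) = lp.single 2 j (y v) := fun y j v => by
    ext i
    rw [diag_apply]
    by_cases h : i = j
    · subst h; simp
    · simp [h]
  have hpmem : ∀ i j, p i j ∈ StarSubalgebra.centralizer ℂ (N : Set (E →L[ℂ] E)) := fun i j => by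
    have h1 : ∀ s ∈ N, s * p i j = p i j * s := fun s hs => by
      ext v
      rw [mul_apply_eq_comp, mul_apply_eq_comp, hp, hp, ← hsingle, hcomm s hs, diag_apply]
    exact (StarSubalgebra.mem_centralizer_iff ℂ).2 fun s hs => ⟨h1 s hs, h1 _ (star_mem hs)⟩
  have hxp : ∀ v, P (diag x v) = diag x (P v) := fun v => by
    have h1 : ∀ j v, P (diag x (lp.single 2 j v)) = diag x (P (lp.single 2 j v)) := fun j v => by
      ext i
      have h2 := congrArg (fun T => T v) ((StarSubalgebra.mem_centralizer_iff ℂ).1 hx _ (hpmem i j)).1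
      rw [hsingle, diag_apply]
      exact h2
    have hs := lp.hasSum_single (p := 2) (by norm_num) v
    have h3 := (hs.mapL (diag x)).mapL P
    have h4 := (hs.mapL P).mapL (diag x)
    simp only [h1] at h3
    exact h3.unique h4
  -- The unit of `N` puts `ζ` itself in `V`, which `diag x` preserves.
  have hζ : ζ ∈ V := V₀.le_topologicalClosure ⟨1, one_mem N, rfl⟩
  have hfin : diag x ζ ∈ V := by
    rw [← Submodule.starProjection_eq_self_iff]
    change P _ = _
    rw [hxp, show P ζ = ζ from Submodule.starProjection_eq_self_iff.2 hζ]
  exact hfin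

/-- Simultaneous approximation at two vectors. -/
theorem diag_prod_mem_closure (N : StarSubalgebra ℂ (E →L[ℂ] E)) {x : E →L[ℂ] E}
    (hx : x ∈ StarSubalgebra.centralizer ℂ
      (StarSubalgebra.centralizer ℂ (N : Set (E →L[ℂ] E)) : Set (E →L[ℂ] E)))
    (ξ : Amp ι E) (η : Amp κ E) :
    (diag x ξ, diag x η) ∈ closure ((fun y => (diag y ξ, diag y η)) '' (N : Set (E →L[ℂ] E))) := by
  -- Two vectors are one vector of a larger amplification.
  have h := diag_mem_closure N hx (ξ.concat η)
  have h2 := map_mem_closure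
    ((reindex Sum.inl Sum.inl_injective : Amp (ι ⊕ κ) E →L[ℂ] Amp ι E).continuous.prodMk
      (reindex Sum.inr Sum.inr_injective : Amp (ι ⊕ κ) E →L[ℂ] Amp κ E).continuous) h
    (t := (fun y => (diag y ξ, diag y η)) '' (N : Set (E →L[ℂ] E))) (by
      rintro _ ⟨y, hy, rfl⟩
      exact ⟨y, hy, rfl⟩)
  exact h2

/-- The normal functional `x ↦ ∑ i, ⟨η i, x (ξ i)⟩`. -/
def vectorFunctional (η ξ : Amp ι E) : (E →L[ℂ] E) →L[ℂ] ℂ :=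
  (innerSL ℂ η).comp (diagAt ξ)

omit [CompleteSpace E] in
theorem vectorFunctional_apply (η ξ : Amp ι E) (x : E →L[ℂ] E) :
    vectorFunctional η ξ x = inner ℂ η (diag x ξ) := rfl

omit [CompleteSpace E] in
theorem hasSum_vectorFunctional (η ξ : Amp ι E) (x : E →L[ℂ] E) :
    HasSum (fun i => inner ℂ (η i) (x (ξ i))) (vectorFunctional η ξ x) :=
  lp.hasSum_inner η (diag x ξ)

/-- Normal functionals agreeing on a *-algebra agree on its bicommutant. -/
theorem vectorFunctional_eq_of_eqOn {N : StarSubalgebra ℂ (E →L[ℂ] E)} {x : E →L[ℂ] E}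
    (hx : x ∈ StarSubalgebra.centralizer ℂ
      (StarSubalgebra.centralizer ℂ (N : Set (E →L[ℂ] E)) : Set (E →L[ℂ] E)))
    {η ξ : Amp ι E} {η' ξ' : Amp κ E}
    (h : ∀ y ∈ N, vectorFunctional η ξ y = vectorFunctional η' ξ' y) :
    vectorFunctional η ξ x = vectorFunctional η' ξ' x := by
  have hc : IsClosed {p : Amp ι E × Amp κ E | inner ℂ η p.1 = inner ℂ η' p.2} :=
    isClosed_eq (by fun_prop) (by fun_prop)
  exact closure_minimal (by rintro _ ⟨y, hy, rfl⟩; exact h y hy) hc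
    (diag_prod_mem_closure N hx ξ ξ')

/-- A normal functional which is positive on a *-algebra is positive on its bicommutant. -/
theorem vectorFunctional_nonneg {N : StarSubalgebra ℂ (E →L[ℂ] E)} {x : E →L[ℂ] E}
    (hx : x ∈ StarSubalgebra.centralizer ℂ
      (StarSubalgebra.centralizer ℂ (N : Set (E →L[ℂ] E)) : Set (E →L[ℂ] E)))
    {η ξ : Amp ι E} (h : ∀ y ∈ N, 0 ≤ vectorFunctional η ξ (star y * y)) :
    0 ≤ vectorFunctional η ξ (star x * x) := by
  -- In this form the value depends continuously on the pair `(diag y η, diag y ξ)`, so no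
  -- approximation of `star x` is needed.
  have he : ∀ y, vectorFunctional η ξ (star y * y) = inner ℂ (diag y η) (diag y ξ) := fun y => by
    rw [vectorFunctional_apply, diag_mul, inner_diag_right, star_star]
  have hc : IsClosed {p : Amp ι E × Amp ι E | 0 ≤ (inner ℂ p.1 p.2 : ℂ)} :=
    isClosed_le continuous_const (by fun_prop)
  rw [he]
  exact closure_minimal (by
      rintro _ ⟨y, hy, rfl⟩
      change 0 ≤ inner ℂ (diag y η) (diag y ξ)
      rw [← he]
      exact h y hy) hc
    (diag_prod_mem_closure N hx η ξ)

/-- A functional on an operator algebra dominated by the vector seminorm of `ξ` is given by a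
second vector. -/
theorem exists_vectorFunctional_of_le {A : StarSubalgebra ℂ (E →L[ℂ] E)} (φ : A →L[ℂ] ℂ)
    (ξ : Amp ι E) (C : ℝ) (h : ∀ a : A, ‖φ a‖ ≤ C * ‖diag (a : E →L[ℂ] E) ξ‖) :
    ∃ η : Amp ι E, ∀ a : A, φ a = vectorFunctional η ξ a := by
  -- By the bound, `φ` factors through `a ↦ diag a ξ`. The factor extends by Hahn–Banach, and the
  -- Riesz vector of the extension is `η`.
  let L : A →ₗ[ℂ] Amp ι E := (diagAt ξ).toLinearMap ∘ₗ (inclusionL A).toLinearMap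
  obtain ⟨f, hf, -⟩ := exists_extension_norm_eq _ (φ.toLinearMap.compLeftInverse L)
  refine ⟨(InnerProductSpace.toDual ℂ _).symm f, fun a => ?_⟩
  rw [vectorFunctional_apply, InnerProductSpace.toDual_symm_apply]
  exact (LinearMap.compLeftInverse_apply_of_bdd φ.toLinearMap L ⟨C, h⟩ a _ rfl).symm.trans
    (hf ⟨L a, a, rfl⟩).symm

end Amplification

/-! ### Normal states as vector functionals -/

section Normal

theorem exists_vectorFunctional_of_isNormalState {E : Type*} [NormedAddCommGroup E]
    [InnerProductSpace ℂ E] [CompleteSpace E] {A : StarSubalgebra ℂ (E →L[ℂ] E)} {φ : State A}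
    (h : IsNormalState φ) : ∃ ξ : Amp ℕ E, ∀ a : A, φ.toCLM a = vectorFunctional ξ ξ a := by
  obtain ⟨ξ, hξ⟩ := h
  -- At the unit the series is `∑ ‖ξ n‖²`, which makes `ξ` square-summable.
  have h1 := (hξ 1).summable.norm
  have hs : Summable fun n => ‖ξ n‖ ^ 2 := by
    refine h1.congr fun n => ?_
    rw [OneMemClass.coe_one, one_apply_eq_self, inner_self_eq_norm_sq_to_K]
    simp
  exact ⟨⟨ξ, memℓp_two_iff.2 hs⟩, fun a =>
    (hξ a).unique (hasSum_vectorFunctional (⟨ξ, memℓp_two_iff.2 hs⟩ : Amp ℕ E) _ _)⟩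

theorem isNormalState_of_vectorFunctional {ι E : Type*} [NormedAddCommGroup E]
    [InnerProductSpace ℂ E] [CompleteSpace E] {A : StarSubalgebra ℂ (E →L[ℂ] E)} {φ : State A}
    (e : ℕ ≃ ι) {ξ : Amp ι E} (h : ∀ a : A, φ.toCLM a = vectorFunctional ξ ξ a) :
    IsNormalState φ := by
  refine ⟨fun n => ξ (e n), fun a => ?_⟩
  have h1 := e.hasSum_iff.2 (hasSum_vectorFunctional ξ ξ a)
  rw [← h a] at h1
  exact h1

/-- A state dominated by a normal state is given by the vectors of the latter on the right. -/
theorem exists_vectorFunctional_of_dominated {ι E : Type*} [NormedAddCommGroup E]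
    [InnerProductSpace ℂ E] [CompleteSpace E] {A : StarSubalgebra ℂ (E →L[ℂ] E)} (φ : State A)
    (ξ : Amp ι E) {w : ℝ} (hw : 0 < w)
    (h : ∀ a : A, w * (φ.toCLM (star a * a)).re ≤
      (vectorFunctional ξ ξ (star a * a : A)).re) :
    ∃ η : Amp ι E, ∀ a : A, φ.toCLM a = vectorFunctional η ξ a := by
  -- The constant comes from `w |φ a|² ≤ w φ (star a * a) ≤ ‖diag a ξ‖²`.
  refine exists_vectorFunctional_of_le φ.toCLM ξ (Real.sqrt w)⁻¹ fun a => ?_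
  have h1 : (vectorFunctional ξ ξ (star a * a : A)).re = ‖diag (a : E →L[ℂ] E) ξ‖ ^ 2 := by
    rw [vectorFunctional_apply, MulMemClass.coe_mul, diag_mul, inner_diag_right,
      StarMemClass.coe_star, star_star, inner_self_eq_norm_sq_to_K]
    norm_cast
  refine (sq_le_sq₀ (norm_nonneg _) (by positivity)).1 ((φ.norm_apply_sq_le a).trans ?_)
  rw [mul_pow, inv_pow, Real.sq_sqrt hw.le, le_inv_mul_iff₀ hw, ← h1]
  exact h a

end Normal

/-! ### Products of square-summable families -/

section ProductVectors

variable {ι κ H K : Type*} [NormedAddCommGroup H] [InnerProductSpace ℂ H]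
  [NormedAddCommGroup K] [InnerProductSpace ℂ K]

/-- The family of products of the members of two square-summable families. -/
def prodVec (ξ : Amp ι (HTensor H K)) (η : Amp κ (HTensor H K)) :
    Amp (ι × κ) (HTensor (HTensor H H) (HTensor K K)) :=
  ⟨fun p => shuffle H K (ξ p.1) (η p.2), memℓp_two_iff.2 <| by
    simp only [norm_shuffle, mul_pow]
    exact ξ.hasSum_norm_sq.summable.mul_of_nonneg η.hasSum_norm_sq.summable
      (fun _ => by positivity) (fun _ => by positivity)⟩

theorem prodVec_apply (ξ : Amp ι (HTensor H K)) (η : Amp κ (HTensor H K)) (p : ι × κ) :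
    prodVec ξ η p = shuffle H K (ξ p.1) (η p.2) := rfl

/-- Each term of the double series factors by `opTensor_shuffle` and `inner_shuffle`; the double
series is summable, so it is the product of the two sums. -/
theorem vectorFunctional_prodVec [CompleteSpace H] [CompleteSpace K]
    (η ξ : Amp ι (HTensor H K)) (η' ξ' : Amp κ (HTensor H K)) (a b : H →L[ℂ] H)
    (m n : K →L[ℂ] K) :
    vectorFunctional (prodVec η η') (prodVec ξ ξ') (opTensor (opTensor a b) (opTensor m n)) =
      vectorFunctional η ξ (opTensor a m) * vectorFunctional η' ξ' (opTensor b n) := by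
  have h1 := hasSum_vectorFunctional η ξ (opTensor a m)
  have h2 := hasSum_vectorFunctional η' ξ' (opTensor b n)
  have h3 := hasSum_vectorFunctional (prodVec η η') (prodVec ξ ξ')
    (opTensor (opTensor a b) (opTensor m n))
  have h4 : ∀ p : ι × κ, inner ℂ (prodVec η η' p)
      (opTensor (opTensor a b) (opTensor m n) (prodVec ξ ξ' p)) =
      inner ℂ (η p.1) (opTensor a m (ξ p.1)) * inner ℂ (η' p.2) (opTensor b n (ξ' p.2)) :=
    fun p => by rw [prodVec_apply, prodVec_apply, opTensor_shuffle, inner_shuffle]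
  rw [funext h4] at h3
  have h5 := h1.mul h2 h3.summable
  exact h3.unique h5

end ProductVectors

/-! ### The von Neumann algebraic case -/

section VonNeumann

variable {H K : Type*} [NormedAddCommGroup H] [InnerProductSpace ℂ H] [CompleteSpace H]
  [FiniteDimensional ℂ H] [NormedAddCommGroup K] [InnerProductSpace ℂ K] [CompleteSpace K]
  {M : VonNeumannAlgebra K}

omit [FiniteDimensional ℂ H] in
theorem opTensor_mem_bipartiteVN (a : H →L[ℂ] H) {m : K →L[ℂ] K} (hm : m ∈ M.toStarSubalgebra) :
    opTensor a m ∈ bipartiteVN H M :=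
  opTensor_mem_vn (by trivial) hm

omit [FiniteDimensional ℂ H] in
theorem opTensor_mem_fourfoldVN (a b : H →L[ℂ] H) {m n : K →L[ℂ] K}
    (hm : m ∈ M.toStarSubalgebra) (hn : n ∈ M.toStarSubalgebra) :
    opTensor (opTensor a b) (opTensor m n) ∈ fourfoldVN H M :=
  opTensor_mem_vn (by trivial) (opTensor_mem_vn hm hn)

/-- The density theorem needs a *-algebra rather than a mere generating set; enlarging the set only
enlarges its bicommutant. -/
theorem fourfoldVN_le_bicommutant_adjoin (M : VonNeumannAlgebra K) :
    fourfoldVN H M ≤ StarSubalgebra.centralizer ℂ (StarSubalgebra.centralizer ℂ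
      (StarAlgebra.adjoin ℂ (productTensors H M.toStarSubalgebra) :
        Set (HTensor (HTensor H H) (HTensor K K) →L[ℂ] HTensor (HTensor H H) (HTensor K K))) :
        Set (HTensor (HTensor H H) (HTensor K K) →L[ℂ] HTensor (HTensor H H) (HTensor K K))) :=
  (fourfoldVN_le_bicommutant M).trans <| StarSubalgebra.centralizer_le ℂ _ _ <|
    SetLike.coe_subset_coe.2 <|
      StarSubalgebra.centralizer_le ℂ _ _ (StarAlgebra.subset_adjoin ℂ _)

theorem vectorFunctional_eq_of_eq_on_productTensors {ι κ : Type*}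
    {η ξ : Amp ι (HTensor (HTensor H H) (HTensor K K))}
    {η' ξ' : Amp κ (HTensor (HTensor H H) (HTensor K K))}
    (h : ∀ (a b : H →L[ℂ] H) (m n : K →L[ℂ] K), m ∈ M.toStarSubalgebra →
      n ∈ M.toStarSubalgebra →
        vectorFunctional η ξ (opTensor (opTensor a b) (opTensor m n)) =
          vectorFunctional η' ξ' (opTensor (opTensor a b) (opTensor m n)))
    {x : HTensor (HTensor H H) (HTensor K K) →L[ℂ] HTensor (HTensor H H) (HTensor K K)}
    (hx : x ∈ fourfoldVN H M) : vectorFunctional η ξ x = vectorFunctional η' ξ' x := by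
  have hle : Submodule.span ℂ (productTensors H M.toStarSubalgebra) ≤
      LinearMap.ker (vectorFunctional η ξ - vectorFunctional η' ξ').toLinearMap := by
    refine Submodule.span_le.2 ?_
    rintro _ ⟨a, b, m, hm, n, hn, rfl⟩
    exact sub_eq_zero.2 (h a b m n hm hn)
  exact vectorFunctional_eq_of_eqOn (fourfoldVN_le_bicommutant_adjoin M hx) fun y hy =>
    sub_eq_zero.1 (hle (adjoin_productTensors_subset_span _ hy))

/-- As `η` and `ξ` may differ, positivity is not automatic. It holds on the span of product tensors
by `product_nonneg` and passes to the bicommutant. -/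
theorem exists_product_stateVN (φ ψ : State (bipartiteVN H M)) {ι κ : Type*}
    {η ξ : Amp ι (HTensor H K)} {η' ξ' : Amp κ (HTensor H K)}
    (hφ : ∀ a : bipartiteVN H M, φ.toCLM a = vectorFunctional η ξ a)
    (hψ : ∀ a : bipartiteVN H M, ψ.toCLM a = vectorFunctional η' ξ' a) :
    ∃ Φ : State (fourfoldVN H M), ∀ x : fourfoldVN H M,
      Φ.toCLM x = vectorFunctional (prodVec η η') (prodVec ξ ξ') x := by
  set F := vectorFunctional (prodVec η η') (prodVec ξ ξ')
  have hprod : ∀ (a b : H →L[ℂ] H) (m n : K →L[ℂ] K) (hm : m ∈ M.toStarSubalgebra)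
      (hn : n ∈ M.toStarSubalgebra), F (opTensor (opTensor a b) (opTensor m n)) =
        φ.toCLM ⟨opTensor a m, opTensor_mem_bipartiteVN a hm⟩ *
          ψ.toCLM ⟨opTensor b n, opTensor_mem_bipartiteVN b hn⟩ := fun a b m n hm hn => by
    rw [hφ, hψ]
    exact vectorFunctional_prodVec ..
  refine ⟨State.ofCLM (F.comp (inclusionL (fourfoldVN H M))) ?_ fun x => ?_, fun x => rfl⟩
  · have h1 := hprod 1 1 1 1 (one_mem _) (one_mem _)
    simp only [opTensor_one] at h1
    exact h1.trans (by
      rw [show (⟨1, _⟩ : bipartiteVN H M) = 1 from rfl, φ.toCLM_one, ψ.toCLM_one, one_mul])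
  · exact vectorFunctional_nonneg (fourfoldVN_le_bicommutant_adjoin M x.2) fun y hy =>
      product_nonneg (fun a m hm => opTensor_mem_bipartiteVN a hm) φ ψ F hprod
        (adjoin_productTensors_subset_span _ hy)

theorem normal_fourfoldVN_state_ext {Φ Ψ : State (fourfoldVN H M)} (hΦ : IsNormalState Φ)
    (hΨ : IsNormalState Ψ)
    (h : ∀ (a b : H →L[ℂ] H) (m n : K →L[ℂ] K) (hm : m ∈ M.toStarSubalgebra)
      (hn : n ∈ M.toStarSubalgebra),
      Φ.toCLM ⟨opTensor (opTensor a b) (opTensor m n), opTensor_mem_fourfoldVN a b hm hn⟩ =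
        Ψ.toCLM ⟨opTensor (opTensor a b) (opTensor m n), opTensor_mem_fourfoldVN a b hm hn⟩) :
    Φ = Ψ := by
  obtain ⟨ξ, hξ⟩ := exists_vectorFunctional_of_isNormalState hΦ
  obtain ⟨η, hη⟩ := exists_vectorFunctional_of_isNormalState hΨ
  refine State.ext fun x => ?_
  rw [hξ, hη]
  refine vectorFunctional_eq_of_eq_on_productTensors (fun a b m n hm hn => ?_) x.2
  have := h a b m n hm hn
  rwa [hξ, hη] at this

/-- The normal product state, given by the products of the vectors of `ω`. -/
theorem exists_normal_tensorSquareVN {ω : State (bipartiteVN H M)} {ξ : Amp ℕ (HTensor H K)}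
    (hξ : ∀ a : bipartiteVN H M, ω.toCLM a = vectorFunctional ξ ξ a) :
    ∃ Ω : State (fourfoldVN H M), (∀ x : fourfoldVN H M,
      Ω.toCLM x = vectorFunctional (prodVec ξ ξ) (prodVec ξ ξ) x) ∧
      IsNormalState Ω ∧ IsTensorSquareVN ω Ω := by
  obtain ⟨Ω, hΩ⟩ := exists_product_stateVN ω ω hξ hξ
  -- The product family is indexed by `ℕ × ℕ`, whereas normality asks for a sequence.
  refine ⟨Ω, hΩ, isNormalState_of_vectorFunctional Nat.pairEquiv.symm hΩ,
    fun a b m n hm hn => ?_⟩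
  rw [← State.toCLM_apply, ← State.toCLM_apply, ← State.toCLM_apply, hΩ, hξ, hξ]
  exact vectorFunctional_prodVec ..

theorem existsUnique_tensorSquareVN (ω : State (bipartiteVN H M)) (hω : IsNormalState ω) :
    ∃! Ω : State (fourfoldVN H M), IsNormalState Ω ∧ IsTensorSquareVN ω Ω := by
  obtain ⟨ξ, hξ⟩ := exists_vectorFunctional_of_isNormalState hω
  obtain ⟨Ω, -, hn, hΩ⟩ := exists_normal_tensorSquareVN hξ
  exact ⟨Ω, ⟨hn, hΩ⟩, fun Ψ hΨ => normal_fourfoldVN_state_ext hΨ.1 hn fun a b m n hm hn =>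
    (hΨ.2 a b m n hm hn).trans (hΩ a b m n hm hn).symm⟩

/-- Competing measures may charge non-normal states, but each component of a finite decomposition is
dominated by a multiple of `ω` and so is represented with the vectors `ξ` of `ω` on the right. -/
theorem eofFourfoldVN_le (ω : State (bipartiteVN H M)) (hω : IsNormalState ω)
    (Ω : State (fourfoldVN H M)) (hn : IsNormalState Ω) (hΩ : IsTensorSquareVN ω Ω) :
    eofFourfoldVN Ω ≤ 2 * eofBipartiteVN ω := by
  obtain ⟨ξ, hξ⟩ := exists_vectorFunctional_of_isNormalState hω
  obtain ⟨Ω', hZ, hn', hΩ'⟩ := exists_normal_tensorSquareVN hξ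
  obtain rfl : Ω = Ω' := (existsUnique_tensorSquareVN ω hω).unique ⟨hn, hΩ⟩ ⟨hn', hΩ'⟩
  refine eof_le_two_mul _ _ _ _ ω Ω fun {ι} _ w φ hw hφ => ?_
  have hdom : ∀ i, ∃ η : Amp ℕ (HTensor H K), ∀ a : bipartiteVN H M,
      (φ i).toCLM a = vectorFunctional η ξ a := fun i => by
    refine exists_vectorFunctional_of_dominated (φ i) ξ (hw i) fun a => ?_
    rw [← hξ, ← hφ, Complex.re_sum]
    have hre : ∀ j, ((w j : ℂ) * (φ j).toCLM (star a * a)).re =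
        w j * ((φ j).toCLM (star a * a)).re := fun j => Complex.re_ofReal_mul _ _
    rw [← hre]
    refine Finset.single_le_sum (f := fun j => ((w j : ℂ) * (φ j).toCLM (star a * a)).re)
      (fun j _ => ?_) (Finset.mem_univ i)
    rw [hre]
    exact mul_nonneg (hw j).le (Complex.le_def.1 ((φ j).toCLM_star_mul_self_nonneg a)).1
  choose η hη using hdom
  choose Φ hΦ using fun i j => exists_product_stateVN (φ i) (φ j) (hη i) (hη j)
  have hval : ∀ i j (a b : H →L[ℂ] H) (m n : K →L[ℂ] K) (hm : m ∈ M.toStarSubalgebra)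
      (hn : n ∈ M.toStarSubalgebra),
      (Φ i j).toCLM ⟨opTensor (opTensor a b) (opTensor m n), opTensor_mem_fourfoldVN a b hm hn⟩ =
        (φ i).toCLM ⟨opTensor a m, opTensor_mem_bipartiteVN a hm⟩ *
          (φ j).toCLM ⟨opTensor b n, opTensor_mem_bipartiteVN b hn⟩ :=
    fun i j a b m n hm hn => by
      rw [hΦ, hη, hη]
      exact vectorFunctional_prodVec ..
  refine ⟨Φ, fun x => ?_, fun i j a b => ?_⟩
  -- The common right family `prodVec ξ ξ` makes the weighted sum a single vector functional, to
  -- which uniqueness on the bicommutant applies.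
  · have hsum : ∀ y, vectorFunctional (∑ i, ∑ j, ((w i : ℂ) * w j) • prodVec (η i) (η j))
        (prodVec ξ ξ) y =
        ∑ i, ∑ j, (w i : ℂ) * w j * vectorFunctional (prodVec (η i) (η j)) (prodVec ξ ξ) y :=
      fun y => by
        simp only [vectorFunctional_apply, sum_inner, inner_smul_left, map_mul,
          Complex.conj_ofReal]
    simp only [hΦ, hZ]
    rw [← hsum]
    refine vectorFunctional_eq_of_eq_on_productTensors (fun a b m n hm hn => ?_) x.2
    have h1 := hZ ⟨_, opTensor_mem_fourfoldVN a b hm hn⟩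
    have h2 := fun i j => (hΦ i j ⟨_, opTensor_mem_fourfoldVN a b hm hn⟩).symm.trans
      (hval i j a b m n hm hn)
    have h3 : Ω.toCLM ⟨_, opTensor_mem_fourfoldVN a b hm hn⟩ = _ := hΩ a b m n hm hn
    simp only at h1 h2
    rw [hsum, ← h1, h3, ← State.toCLM_apply, ← State.toCLM_apply, ← hφ, ← hφ,
      Finset.sum_mul_sum]
    simp only [h2]
    exact Finset.sum_congr rfl fun i _ => Finset.sum_congr rfl fun j _ => by ring
  · have h := hval i j a b 1 1 (one_mem _) (one_mem _)
    simp only [opTensor_one] at h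
    exact h

end VonNeumann

end EntForm

end

theorem mainTheorem8 {H₁ H₂ : Type*}
    [NormedAddCommGroup H₁] [InnerProductSpace ℂ H₁] [CompleteSpace H₁] [FiniteDimensional ℂ H₁]
    [NormedAddCommGroup H₂] [InnerProductSpace ℂ H₂] [CompleteSpace H₂] :
    (∀ M : StarSubalgebra ℂ (H₂ →L[ℂ] H₂), IsClosed (M : Set (H₂ →L[ℂ] H₂)) →
      ∀ ω : EntForm.State (EntForm.bipartite H₁ M),
        (∃! Ω : EntForm.State (EntForm.fourfold H₁ M), EntForm.IsTensorSquare ω Ω) ∧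
        ∀ Ω : EntForm.State (EntForm.fourfold H₁ M), EntForm.IsTensorSquare ω Ω →
          EntForm.eofFourfold Ω ≤ 2 * EntForm.eofBipartite ω) ∧
    (∀ M : VonNeumannAlgebra H₂,
      ∀ ω : EntForm.State (EntForm.bipartiteVN H₁ M), EntForm.IsNormalState ω →
        (∃! Ω : EntForm.State (EntForm.fourfoldVN H₁ M),
          EntForm.IsNormalState Ω ∧ EntForm.IsTensorSquareVN ω Ω) ∧
        ∀ Ω : EntForm.State (EntForm.fourfoldVN H₁ M),
          EntForm.IsNormalState Ω → EntForm.IsTensorSquareVN ω Ω →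
            EntForm.eofFourfoldVN Ω ≤ 2 * EntForm.eofBipartiteVN ω) := by
  refine ⟨fun M _ ω => ⟨EntForm.existsUnique_tensorSquare ω, EntForm.eofFourfold_le ω⟩,
    fun M ω hω => ⟨EntForm.existsUnique_tensorSquareVN ω hω, EntForm.eofFourfoldVN_le ω hω⟩⟩
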